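/- Let $\epsilon=e^{2\pi i/3}$ and let $G_{216}\subset \mathrm{PGL}(3,\mathbb C)$ be the Hessian group, i.e. the group of projective transformations of $\mathbb P^2$ that preserve the Hesse pencil, the linear system of cubics spanned by $x^3+y^3+z^3$ and $xyz$. Consider the projective transformations $$g_1(x,y,z)=(y,z,x),\qquad g_2(x,y,z)=(x,\epsilon y,\epsilon^2 z),$$ $$g_3(x,y,z)=(x+y+z,\;x+\epsilon y+\epsilon^2 z,\;x+\epsilon^2 y+\epsilon z),\qquad g_4(x,y,z)=(x,\epsilon y,\epsilon z),$$ put $\Gamma=\langle g_1,g_2\rangle$ and $L=\langle g_3,g_4\rangle$ (the standard copy of $\mathrm{SL}(2,\mathbb F_3)$ in $G_{216}$), let $Q_8$ be a Sylow $2$-subgroup of $L$, and let $H_{72}$ be the subgroup generated by $\Gamma$ and $Q_8$. Let $$X=\{\,w^2+\Phi_6(x,y,z)=0\,\}\subset\mathbb P(1,1,1,3),\qquad \Phi_6=x^6+y^6+z^6-10(x^3y^3+x^3z^3+y^3z^3),$$ a complex ($K3$) surface, and let $q:X\to\mathbb P^2$, $[x:y:z:w]\mapsto[x:y:z]$, be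 the double cover branched along $\Phi_6=0$. Then: 1. $H_{72}\subset G_{216}$ is a normal subgroup of $G_{216}$, $Q_8$ is isomorphic to the quaternion group of order $8$, and $H_{72}=\Gamma\rtimes Q_8$ (i.e. $\Gamma$ is normal in $H_{72}$ and $\Gamma\cap Q_8=1$). 2. The space $\Omega^2(X)$ of holomorphic $2$-forms on $X$ is one-dimensional. 3. There is an injective homomorphism $\rho$ from $G_{216}$ to the group of holomorphic automorphisms of $X$ which lifts the action on the plane, i.e. $q(\rho(g)p)=g\cdot q(p)$ for all $g\in G_{216}$ and $p\in X$, and such that for every $g\in H_{72}$ the automorphism $\rho(g)$ is symplectic, i.e. $\rho(g)^*\eta=\eta$ for every $\eta\in\Omega^2(X)$. -/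

import Mathlib

open scoped Manifold ContDiff Topology MatrixGroups LinearAlgebra.Projectivization

noncomputable section

/-! ### Complex surfaces: holomorphic automorphisms and holomorphic 2-forms -/

namespace ComplexSurface

/-- The group of holomorphic automorphisms of a complex surface. -/
def HolAut (M : Type) [TopologicalSpace M] [ChartedSpace (ℂ × ℂ) M] :
    Subgroup (Equiv.Perm M) where
  carrier := {f | MDifferentiable 𝓘(ℂ, ℂ × ℂ) 𝓘(ℂ, ℂ × ℂ) f ∧
    MDifferentiable 𝓘(ℂ, ℂ × ℂ) 𝓘(ℂ, ℂ × ℂ) f.symm}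
  mul_mem' := fun ha hb => ⟨ha.1.comp hb.1, hb.2.comp ha.2⟩
  one_mem' := ⟨mdifferentiable_id, mdifferentiable_id⟩
  inv_mem' := fun ha => ⟨ha.2, ha.1⟩

/-- A (not necessarily continuous) section of the bundle of alternating 2-forms. -/
abbrev TwoFormSection (M : Type) [TopologicalSpace M] [ChartedSpace (ℂ × ℂ) M] : Type :=
  (p : M) → (TangentSpace 𝓘(ℂ, ℂ × ℂ) p) [⋀^Fin 2]→L[ℂ] ℂ

/-- The pullback of a 2-form along a self-map `f`. -/
def pullback {M : Type} [TopologicalSpace M] [ChartedSpace (ℂ × ℂ) M]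
    (f : M → M) (η : TwoFormSection M) : TwoFormSection M := fun p =>
  (η (f p)).compContinuousLinearMap (mfderiv 𝓘(ℂ, ℂ × ℂ) 𝓘(ℂ, ℂ × ℂ) f p)

/-- The expression of a 2-form in the chart `φ`: its pullback along `φ.symm`, as a function
with values in the alternating 2-forms on `ℂ × ℂ`. -/
def localForm {M : Type} [TopologicalSpace M] [ChartedSpace (ℂ × ℂ) M]
    (η : TwoFormSection M) (φ : OpenPartialHomeomorph M (ℂ × ℂ)) (s : ℂ × ℂ) :
    (ℂ × ℂ) [⋀^Fin 2]→L[ℂ] ℂ :=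
  (η (φ.symm s)).compContinuousLinearMap
    (mfderiv 𝓘(ℂ, ℂ × ℂ) 𝓘(ℂ, ℂ × ℂ) φ.symm s)

/-- The space `Ω²(M)` of global holomorphic 2-forms. -/
def HolTwoForms (M : Type) [TopologicalSpace M] [ChartedSpace (ℂ × ℂ) M] :
    Submodule ℂ (TwoFormSection M) where
  carrier := {η | ∀ φ ∈ atlas (ℂ × ℂ) M, DifferentiableOn ℂ (localForm η φ) φ.target}
  add_mem' := fun ha hb φ hφ => (ha φ hφ).add (hb φ hφ)
  zero_mem' := fun _ _ => differentiableOn_const (0 : (ℂ × ℂ) [⋀^Fin 2]→L[ℂ] ℂ)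
  smul_mem' := fun c _ ha φ hφ => (ha φ hφ).const_smul c

/-- A self-map is symplectic if it acts identically on the holomorphic 2-forms. -/
def IsSymplectic {M : Type} [TopologicalSpace M] [ChartedSpace (ℂ × ℂ) M] (f : M → M) : Prop :=
  ∀ η ∈ HolTwoForms M, pullback f η = η

end ComplexSurface

/-! ### The Hessian group -/

namespace Hessian

open MvPolynomial in
/-- The Hesse pencil: the linear system of plane cubics spanned by `x³ + y³ + z³` and `xyz`. -/
def hessePencil : Submodule ℂ (MvPolynomial (Fin 3) ℂ) :=
  Submodule.span ℂ {X 0 ^ 3 + X 1 ^ 3 + X 2 ^ 3, X 0 * X 1 * X 2}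

/-- The linear substitution `f(x) ↦ f(Ax)`. -/
def linSubst (A : Matrix (Fin 3) (Fin 3) ℂ) :
    MvPolynomial (Fin 3) ℂ →ₗ[ℂ] MvPolynomial (Fin 3) ℂ :=
  (MvPolynomial.bind₁ A.toMvPolynomial).toLinearMap

theorem linSubst_one : linSubst 1 = LinearMap.id := by
  ext1 f
  simp [linSubst, Matrix.toMvPolynomial_one]

theorem linSubst_mul (A B : Matrix (Fin 3) (Fin 3) ℂ) :
    linSubst (A * B) = linSubst B ∘ₗ linSubst A := by
  refine LinearMap.ext fun f => ?_
  simp only [linSubst, AlgHom.toLinearMap_apply, LinearMap.comp_apply, MvPolynomial.bind₁_bind₁]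
  congr 2
  funext i
  rw [Matrix.toMvPolynomial_mul]

/-- The linear automorphisms of `ℂ³` that preserve the Hesse pencil. -/
def linearStabilizer : Subgroup (GL (Fin 3) ℂ) where
  carrier := {A | hessePencil.map (linSubst A.val) = hessePencil}
  mul_mem' := fun {A B} ha hb => by
    simp only [Set.mem_ofPred_eq] at *
    rw [Units.val_mul, linSubst_mul, Submodule.map_comp, ha, hb]
  one_mem' := by
    simp only [Set.mem_ofPred_eq]
    rw [Units.val_one, linSubst_one, Submodule.map_id]
  inv_mem' := fun {A} ha => by
    simp only [Set.mem_ofPred_eq] at *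
    conv_lhs => rw [← ha]
    rw [← Submodule.map_comp, ← linSubst_mul, ← Units.val_mul, mul_inv_cancel,
      Units.val_one, linSubst_one, Submodule.map_id]

/-- The Hessian group `G₂₁₆`: the projective transformations preserving the Hesse pencil. -/
def hessianGroup : Subgroup PGL(Fin 3, ℂ) :=
  linearStabilizer.map Matrix.ProjGenLinGroup.mk

/-- A primitive third root of unity. -/
def ε : ℂ := Complex.exp (2 * Real.pi * Complex.I / 3)

theorem ε_prim : IsPrimitiveRoot ε 3 := by
  have := Complex.isPrimitiveRoot_exp 3 (by norm_num)
  simpa [ε] using this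

/-- `(x, y, z) ↦ (y, z, x)`. -/
def m₁ : Matrix (Fin 3) (Fin 3) ℂ := !![0, 1, 0; 0, 0, 1; 1, 0, 0]

/-- `(x, y, z) ↦ (x, εy, ε²z)`. -/
def m₂ : Matrix (Fin 3) (Fin 3) ℂ := !![1, 0, 0; 0, ε, 0; 0, 0, ε ^ 2]

/-- `(x, y, z) ↦ (x + y + z, x + εy + ε²z, x + ε²y + εz)`. -/
def m₃ : Matrix (Fin 3) (Fin 3) ℂ := !![1, 1, 1; 1, ε, ε ^ 2; 1, ε ^ 2, ε]

/-- `(x, y, z) ↦ (x, εy, εz)`. -/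
def m₄ : Matrix (Fin 3) (Fin 3) ℂ := !![1, 0, 0; 0, ε, 0; 0, 0, ε]

theorem ε_ne : ε ≠ 0 := ε_prim.ne_zero (by norm_num)

theorem det_m₁ : m₁.det ≠ 0 := by simp [m₁, Matrix.det_fin_three]

theorem det_m₂ : m₂.det ≠ 0 := by simp [m₂, Matrix.det_fin_three, ε_ne]

theorem det_m₃ : m₃.det ≠ 0 := by
  have h3 : ε ^ 3 = 1 := ε_prim.pow_eq_one
  have h1 : ε ≠ 1 := ε_prim.ne_one (by norm_num)
  have h2 : ε ^ 2 + ε + 1 = 0 := by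
    have : (ε - 1) * (ε ^ 2 + ε + 1) = 0 := by linear_combination h3
    exact (mul_eq_zero.1 this).resolve_left (sub_ne_zero.2 h1)
  have : m₃.det = 3 * ε * (ε - 1) := by
    simp only [m₃, Matrix.det_fin_three, Matrix.of_apply, Matrix.cons_val', Matrix.cons_val_zero,
      Matrix.cons_val_one, Matrix.cons_val, Matrix.cons_val_fin_one]
    linear_combination (-ε) * h3
  rw [this]
  exact mul_ne_zero (mul_ne_zero (by norm_num) ε_ne) (sub_ne_zero.2 h1)

theorem det_m₄ : m₄.det ≠ 0 := by simp [m₄, Matrix.det_fin_three, ε_ne]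

/-- The projective transformation given by an invertible matrix. -/
def projOf (A : Matrix (Fin 3) (Fin 3) ℂ) (h : A.det ≠ 0) : PGL(Fin 3, ℂ) :=
  Matrix.ProjGenLinGroup.mk (Matrix.GeneralLinearGroup.mkOfDetNeZero A h)

def g₁ : PGL(Fin 3, ℂ) := projOf m₁ det_m₁
def g₂ : PGL(Fin 3, ℂ) := projOf m₂ det_m₂
def g₃ : PGL(Fin 3, ℂ) := projOf m₃ det_m₃
def g₄ : PGL(Fin 3, ℂ) := projOf m₄ det_m₄

/-- The subgroup `Γ ≅ (ℤ/3)²`, acting on the smooth members of the pencil by translations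
by 3-torsion points. -/
def Γ : Subgroup PGL(Fin 3, ℂ) := Subgroup.closure {g₁, g₂}

/-- The complement `⟨g₃, g₄⟩ ≅ SL(2, 𝔽₃)` of `Γ` in the Hessian group. -/
def SL23 : Subgroup PGL(Fin 3, ℂ) := Subgroup.closure {g₃, g₄}

/-- A Sylow 2-subgroup of `SL23`, as a group of projective transformations. -/
def Q8 (Q : Sylow 2 SL23) : Subgroup PGL(Fin 3, ℂ) :=
  (Q : Subgroup SL23).map SL23.subtype

/-- The subgroup `H₇₂ = Γ ⋊ Q₈`. -/
def H72 (Q : Sylow 2 SL23) : Subgroup PGL(Fin 3, ℂ) := Γ ⊔ Q8 Q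

end Hessian

/-! ### The surface `w² + Φ₆(x, y, z) = 0` in `ℙ(1, 1, 1, 3)` -/

namespace HessianK3

/-- Points `(x, y, z; w)` of the affine space `ℂ⁴ = ℂ³ × ℂ`. -/
abbrev V : Type := (Fin 3 → ℂ) × ℂ

/-- Nonzero points of `ℂ⁴` are equivalent if they differ by the action of `c ∈ ℂˣ` with
weights `(1, 1, 1, 3)`. -/
def weightedSetoid : Setoid {a : V // a ≠ 0} where
  r a b := ∃ c : ℂ, c ≠ 0 ∧ b.1 = (c • a.1.1, c ^ 3 * a.1.2)
  iseqv :=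
    { refl := fun a => ⟨1, one_ne_zero, by simp⟩
      symm := by
        rintro a b ⟨c, hc, h⟩
        refine ⟨c⁻¹, inv_ne_zero hc, ?_⟩
        rw [h]
        ext
        · simp [hc]
        · simp [hc]
      trans := by
        rintro a b d ⟨c, hc, h⟩ ⟨c', hc', h'⟩
        refine ⟨c' * c, mul_ne_zero hc' hc, ?_⟩
        rw [h', h]
        ext
        · simp [mul_assoc]
        · simp [mul_pow, mul_assoc] }

/-- The weighted projective space `ℙ(1, 1, 1, 3)`, with the quotient topology. -/
def P1113 : Type := Quotient weightedSetoid

instance : TopologicalSpace P1113 := inferInstanceAs (TopologicalSpace (Quotient weightedSetoid))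

/-- The point with the given weighted homogeneous coordinates. -/
def P1113.mk (a : V) (h : a ≠ 0) : P1113 := Quotient.mk weightedSetoid ⟨a, h⟩

/-- The sextic `Φ₆`. -/
def Φ₆ (v : Fin 3 → ℂ) : ℂ :=
  v 0 ^ 6 + v 1 ^ 6 + v 2 ^ 6 -
    10 * (v 0 ^ 3 * v 1 ^ 3 + v 0 ^ 3 * v 2 ^ 3 + v 1 ^ 3 * v 2 ^ 3)

/-- The weighted homogeneous equation of the surface. -/
def F (a : V) : ℂ := a.2 ^ 2 + Φ₆ a.1

theorem F_weighted (c : ℂ) (a : V) : F (c • a.1, c ^ 3 * a.2) = c ^ 6 * F a := by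
  simp only [F, Φ₆, Pi.smul_apply, smul_eq_mul]
  ring

/-- The vanishing of `F` at a point of `ℙ(1, 1, 1, 3)`. -/
def Vanishes : P1113 → Prop :=
  Quotient.lift (fun a : {a : V // a ≠ 0} => F a.1 = 0) (by
    rintro a b ⟨c, hc, h⟩
    simp only [h, F_weighted, mul_eq_zero, eq_iff_iff]
    simp [hc])

@[simp] theorem vanishes_mk (a : V) (h : a ≠ 0) : Vanishes (P1113.mk a h) ↔ F a = 0 := Iff.rfl

/-- The surface `X : w² + Φ₆(x, y, z) = 0` in `ℙ(1, 1, 1, 3)`, with the subspace topology. -/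
def X : Type := {p : P1113 // Vanishes p}

instance : TopologicalSpace X := inferInstanceAs (TopologicalSpace {p : P1113 // Vanishes p})

/-- The point of `X` with the given coordinates. -/
def X.mk (a : V) (h : a ≠ 0) (hF : F a = 0) : X := ⟨P1113.mk a h, hF⟩

theorem X.ind {P : X → Prop} (h : ∀ a ha hF, P (X.mk a ha hF)) (p : X) : P p := by
  obtain ⟨p, hp⟩ := p
  induction p using Quotient.inductionOn with
  | h a => exact h a.1 a.2 hp

theorem fst_ne_zero {a : V} (h : a ≠ 0) (hF : F a = 0) : a.1 ≠ 0 := by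
  intro h1
  apply h
  have : a.2 ^ 2 = 0 := by simpa [F, Φ₆, h1] using hF
  exact Prod.ext h1 (pow_eq_zero_iff (two_ne_zero) |>.1 this)

theorem X.mk_eq_mk {a b : V} {ha : a ≠ 0} {hb : b ≠ 0} {hFa : F a = 0} {hFb : F b = 0} :
    X.mk a ha hFa = X.mk b hb hFb ↔ ∃ c : ℂ, c ≠ 0 ∧ b = (c • a.1, c ^ 3 * a.2) := by
  refine Subtype.ext_iff.trans ?_
  exact Quotient.eq (r := weightedSetoid)

theorem X.exists_rep (p : X) : ∃ a : V, ∃ (h : a ≠ 0) (hF : F a = 0), p = X.mk a h hF := by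
  induction p using X.ind with
  | h a ha hF => exact ⟨a, ha, hF, rfl⟩

/-- A choice of weighted homogeneous coordinates of a point of `X`. -/
def X.rep (p : X) : V := p.exists_rep.choose

theorem X.rep_ne (p : X) : p.rep ≠ 0 := p.exists_rep.choose_spec.choose

theorem X.F_rep (p : X) : F p.rep = 0 := p.exists_rep.choose_spec.choose_spec.choose

theorem X.mk_rep (p : X) : X.mk p.rep p.rep_ne p.F_rep = p :=
  p.exists_rep.choose_spec.choose_spec.choose_spec.symm

/-- The double cover `q : X → ℙ²`, `[x : y : z : w] ↦ [x : y : z]`. -/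
def q (p : X) : ℙ ℂ (Fin 3 → ℂ) :=
  Projectivization.mk ℂ p.rep.1 (fst_ne_zero p.rep_ne p.F_rep)

theorem q_mk (a : V) (h : a ≠ 0) (hF : F a = 0) :
    q (X.mk a h hF) = Projectivization.mk ℂ a.1 (fst_ne_zero h hF) := by
  obtain ⟨c, hc, h'⟩ := X.mk_eq_mk.1 (X.mk_rep (X.mk a h hF))
  rw [q, Projectivization.mk_eq_mk_iff']
  refine ⟨c⁻¹, ?_⟩
  rw [show a.1 = c • (X.mk a h hF).rep.1 from congrArg Prod.fst h', smul_smul,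
    inv_mul_cancel₀ hc, one_smul]

/-! #### The complex structure of `X` -/

/-- The normalization `(v, w) ↦ (v / vᵢ, w / vᵢ³)`. -/
def normalize (i : Fin 3) (a : V) : V := ((a.1 i)⁻¹ • a.1, (a.1 i)⁻¹ ^ 3 * a.2)

/-- The affine coordinates on the part `vᵢ ≠ 0` of `ℙ(1, 1, 1, 3)`. -/
def affineCoord (i : Fin 3) : P1113 → V :=
  Quotient.lift (fun a : {a : V // a ≠ 0} => normalize i a.1) (by
    rintro a b ⟨c, hc, h⟩
    simp only [normalize, h, Pi.smul_apply, smul_eq_mul, mul_inv, smul_smul]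
    ext
    · simp only [Pi.smul_apply, smul_eq_mul]
      field_simp
    · simp only
      field_simp)

@[simp] theorem affineCoord_mk (i : Fin 3) (a : V) (h : a ≠ 0) :
    affineCoord i (P1113.mk a h) = normalize i a := rfl

theorem normalize_apply {i : Fin 3} {a : V} (h : a.1 i ≠ 0) : (normalize i a).1 i = 1 := by
  simp [normalize, h]

theorem normalize_eq_self {i : Fin 3} {a : V} (h : a.1 i = 1) : normalize i a = a := by
  simp [normalize, h]

theorem F_normalize {i : Fin 3} {a : V} (hF : F a = 0) : F (normalize i a) = 0 := by
  rw [normalize, F_weighted, hF, mul_zero]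

theorem ne_zero_of_apply {i : Fin 3} {a : V} (h : a.1 i = 1) : a ≠ 0 := by
  rintro rfl
  simp at h

theorem mk_normalize {i : Fin 3} {a : V} (h : a ≠ 0) (hF : F a = 0) (hi : a.1 i ≠ 0) :
    X.mk (normalize i a) (ne_zero_of_apply (normalize_apply hi)) (F_normalize hF) =
      X.mk a h hF :=
  (X.mk_eq_mk.2 ⟨(a.1 i)⁻¹, inv_ne_zero hi, rfl⟩).symm

/-- The map `(v, w) ↦ (vᵢ, F(v, w), ℓ(v, w))`. -/
def slice (i : Fin 3) (ℓ : V →L[ℂ] ℂ × ℂ) (a : V) : (ℂ × ℂ) × (ℂ × ℂ) :=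
  ((a.1 i, F a), ℓ a)

theorem contDiff_F : ContDiff ℂ ω F := by
  unfold F Φ₆
  fun_prop

theorem contDiff_slice (i : Fin 3) (ℓ : V →L[ℂ] ℂ × ℂ) : ContDiff ℂ ω (slice i ℓ) := by
  have := contDiff_F
  unfold slice
  fun_prop

/-- Data for a chart of `X`: a linear map `ℓ : ℂ⁴ → ℂ²`, an index `i`, and a local biholomorphism
of `ℂ⁴` of the form `(v, w) ↦ (vᵢ, F(v, w), ℓ(v, w))`; the two components of `ℓ` are then local
coordinates on the affine surface `vᵢ = 1`, `F = 0`. -/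
structure ChartData where
  i : Fin 3
  ℓ : V →L[ℂ] ℂ × ℂ
  Ψ : OpenPartialHomeomorph V ((ℂ × ℂ) × (ℂ × ℂ))
  coe_eq : ∀ a, Ψ a = slice i ℓ a
  contDiff_symm : ContDiffOn ℂ ω Ψ.symm Ψ.target

namespace ChartData

variable (D : ChartData)

/-- The points of `ℂ² = {(1, 0)} × ℂ²` where the local inverse is defined. -/
def dom : Set (ℂ × ℂ) := {s | (((1 : ℂ), (0 : ℂ)), s) ∈ D.Ψ.target}

/-- The point of the affine surface with local coordinates `s`. -/
def lift (s : ℂ × ℂ) : V := D.Ψ.symm ((1, 0), s)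

theorem slice_lift {s : ℂ × ℂ} (hs : s ∈ D.dom) : slice D.i D.ℓ (D.lift s) = ((1, 0), s) := by
  rw [← D.coe_eq]
  exact D.Ψ.right_inv hs

theorem lift_apply {s : ℂ × ℂ} (hs : s ∈ D.dom) : (D.lift s).1 D.i = 1 :=
  congrArg (fun t => t.1.1) (D.slice_lift hs)

theorem F_lift {s : ℂ × ℂ} (hs : s ∈ D.dom) : F (D.lift s) = 0 :=
  congrArg (fun t => t.1.2) (D.slice_lift hs)

theorem ℓ_lift {s : ℂ × ℂ} (hs : s ∈ D.dom) : D.ℓ (D.lift s) = s :=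
  congrArg (fun t => t.2) (D.slice_lift hs)

theorem lift_ne {s : ℂ × ℂ} (hs : s ∈ D.dom) : D.lift s ≠ 0 :=
  ne_zero_of_apply (D.lift_apply hs)

theorem lift_mem {s : ℂ × ℂ} (hs : s ∈ D.dom) : D.lift s ∈ D.Ψ.source :=
  D.Ψ.map_target hs

theorem isOpen_dom : IsOpen D.dom :=
  D.Ψ.open_target.preimage (by fun_prop : Continuous fun s : ℂ × ℂ => (((1 : ℂ), (0 : ℂ)), s))

theorem contDiffOn_lift : ContDiffOn ℂ ω D.lift D.dom :=
  D.contDiff_symm.comp (t := D.Ψ.target)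
    (by fun_prop : ContDiff ℂ ω fun s : ℂ × ℂ => (((1 : ℂ), (0 : ℂ)), s)).contDiffOn
    (fun _ hs => hs)

end ChartData

/-- Some point of `X`. -/
def basePoint : X := X.mk (![1, 0, 0], Complex.I)
  (fun h => one_ne_zero (congrFun (congrArg Prod.fst h) 0)) (by simp [F, Φ₆])

/-- The part of `ℙ(1, 1, 1, 3)` where the `i`-th coordinate is nonzero. -/
def affinePart (i : Fin 3) : Set P1113 := {p | (affineCoord i p).1 i = 1}

theorem mk_mem_affinePart {i : Fin 3} {a : V} {h : a ≠ 0} :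
    P1113.mk a h ∈ affinePart i ↔ a.1 i ≠ 0 := by
  constructor
  · intro h1 h0
    simp [affinePart, normalize, h0] at h1
  · intro h0
    exact normalize_apply h0

theorem isQuotientMap_mk :
    Topology.IsQuotientMap (fun a : {a : V // a ≠ 0} => P1113.mk a.1 a.2) :=
  isQuotientMap_quotient_mk'

theorem isOpen_affinePart (i : Fin 3) : IsOpen (affinePart i) := by
  rw [← isQuotientMap_mk.isOpen_preimage]
  have : (fun a : {a : V // a ≠ 0} => P1113.mk a.1 a.2) ⁻¹' affinePart i =
      {a | a.1.1 i ≠ 0} := by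
    ext a
    exact mk_mem_affinePart
  rw [this]
  exact isOpen_ne_fun (by fun_prop) (by fun_prop)

theorem contDiffOn_normalize (i : Fin 3) : ContDiffOn ℂ ω (normalize i) {a | a.1 i ≠ 0} := by
  have h : ContDiffOn ℂ ω (fun a : V => (a.1 i)⁻¹) {a | a.1 i ≠ 0} :=
    ContDiffOn.inv (by fun_prop) (fun _ h => h)
  unfold normalize
  exact (h.smul (by fun_prop)).prodMk ((h.pow 3).mul (by fun_prop))

theorem continuousOn_affineCoord (i : Fin 3) : ContinuousOn (affineCoord i) (affinePart i) := by
  rw [isQuotientMap_mk.continuousOn_isOpen_iff (isOpen_affinePart i)]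
  refine ContinuousOn.comp (g := normalize i) (f := Subtype.val) (t := {a | a.1 i ≠ 0})
    (contDiffOn_normalize i).continuousOn continuous_subtype_val.continuousOn ?_
  intro a ha
  exact mk_mem_affinePart.1 ha

namespace ChartData

variable (D : ChartData)

open Classical in
/-- The chart of `X` defined by `D`: the point `p` with affine coordinates `a` (such that `aᵢ = 1`)
is sent to `ℓ(a)`. -/
def chart : OpenPartialHomeomorph X (ℂ × ℂ) where
  toFun p := D.ℓ (affineCoord D.i p.1)
  invFun s := if h : s ∈ D.dom then X.mk (D.lift s) (D.lift_ne h) (D.F_lift h) else basePoint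
  source := {p | p.1 ∈ affinePart D.i ∧ affineCoord D.i p.1 ∈ D.Ψ.source}
  target := D.dom
  map_source' := by
    intro p hp
    induction p using X.ind with
    | h a ha hF =>
      have hi : a.1 D.i ≠ 0 := mk_mem_affinePart.1 hp.1
      have h2 := D.Ψ.map_source hp.2
      rw [D.coe_eq] at h2
      have h3 : slice D.i D.ℓ (normalize D.i a) = ((1, 0), D.ℓ (normalize D.i a)) := by
        rw [slice, normalize_apply hi, F_normalize hF]
      change slice D.i D.ℓ (normalize D.i a) ∈ _ at h2
      rw [h3] at h2
      exact h2
  map_target' := by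
    intro s hs
    rw [dif_pos hs]
    have h1 := D.lift_apply hs
    refine ⟨mk_mem_affinePart.2 (by rw [h1]; exact one_ne_zero), ?_⟩
    change normalize D.i (D.lift s) ∈ _
    rw [normalize_eq_self h1]
    exact D.lift_mem hs
  left_inv' := by
    intro p hp
    induction p using X.ind with
    | h a ha hF =>
      have hi : a.1 D.i ≠ 0 := mk_mem_affinePart.1 hp.1
      have h2 : normalize D.i a ∈ D.Ψ.source := hp.2
      have h3 : D.Ψ (normalize D.i a) = ((1, 0), D.ℓ (normalize D.i a)) := by
        rw [D.coe_eq, slice, normalize_apply hi, F_normalize hF]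
      have h4 : D.ℓ (normalize D.i a) ∈ D.dom := by
        have := D.Ψ.map_source h2
        rw [h3] at this
        exact this
      have h5 : D.lift (D.ℓ (normalize D.i a)) = normalize D.i a := by
        rw [lift, ← h3]
        exact D.Ψ.left_inv h2
      change (if h : D.ℓ (normalize D.i a) ∈ D.dom then _ else _) = _
      rw [dif_pos h4]
      refine Eq.trans ?_ (mk_normalize ha hF hi)
      exact X.mk_eq_mk.2 ⟨1, one_ne_zero, by rw [one_smul, one_pow, one_mul]; exact h5.symm⟩
  right_inv' := by
    intro s hs
    rw [dif_pos hs]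
    change D.ℓ (normalize D.i (D.lift s)) = s
    rw [normalize_eq_self (D.lift_apply hs), D.ℓ_lift hs]
  open_source := by
    have h := (continuousOn_affineCoord D.i).isOpen_inter_preimage (isOpen_affinePart D.i)
      D.Ψ.open_source
    exact h.preimage continuous_subtype_val
  open_target := D.isOpen_dom
  continuousOn_toFun := by
    refine D.ℓ.continuous.comp_continuousOn ?_
    exact (continuousOn_affineCoord D.i).comp continuous_subtype_val.continuousOn
      (fun p hp => hp.1)
  continuousOn_invFun := by
    rw [continuousOn_iff_continuous_domRestrict]
    have : Continuous fun s : D.dom => X.mk (D.lift s) (D.lift_ne s.2) (D.F_lift s.2) := by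
      refine Continuous.subtype_mk ?_ _
      refine isQuotientMap_mk.continuous.comp
        (g := fun a : {a : V // a ≠ 0} => P1113.mk a.1 a.2)
        (f := fun s : D.dom => (⟨D.lift s, D.lift_ne s.2⟩ : {a : V // a ≠ 0})) ?_
      exact Continuous.subtype_mk
        (continuousOn_iff_continuous_domRestrict.1 D.contDiffOn_lift.continuousOn) _
    convert this using 1
    funext s
    simp [Set.domRestrict, s.2]

theorem chart_symm_apply {s : ℂ × ℂ} (hs : s ∈ D.dom) :
    D.chart.symm s = X.mk (D.lift s) (D.lift_ne hs) (D.F_lift hs) := dif_pos hs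

theorem chart_mk (a : V) (h : a ≠ 0) (hF : F a = 0) :
    D.chart (X.mk a h hF) = D.ℓ (normalize D.i a) := rfl

theorem mk_mem_source (a : V) (h : a ≠ 0) (hF : F a = 0) :
    X.mk a h hF ∈ D.chart.source ↔ a.1 D.i ≠ 0 ∧ normalize D.i a ∈ D.Ψ.source :=
  and_congr mk_mem_affinePart Iff.rfl

end ChartData

/-- The derivative of `F`. -/
def dF (a : V) : V →ₗ[ℂ] ℂ where
  toFun ξ := 2 * a.2 * ξ.2 +
    ((6 * a.1 0 ^ 5 - 30 * a.1 0 ^ 2 * (a.1 1 ^ 3 + a.1 2 ^ 3)) * ξ.1 0 +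
     (6 * a.1 1 ^ 5 - 30 * a.1 1 ^ 2 * (a.1 0 ^ 3 + a.1 2 ^ 3)) * ξ.1 1 +
     (6 * a.1 2 ^ 5 - 30 * a.1 2 ^ 2 * (a.1 0 ^ 3 + a.1 1 ^ 3)) * ξ.1 2)
  map_add' ξ η := by simp; ring
  map_smul' c ξ := by simp; ring

theorem fderiv_F (a ξ : V) : fderiv ℂ F a ξ = dF a ξ := by
  have hx (i : Fin 3) : HasFDerivAt (fun b : V => b.1 i)
      ((ContinuousLinearMap.proj i).comp (ContinuousLinearMap.fst ℂ (Fin 3 → ℂ) ℂ)) a :=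
    ((ContinuousLinearMap.proj i).comp (ContinuousLinearMap.fst ℂ (Fin 3 → ℂ) ℂ)).hasFDerivAt
  have hw : HasFDerivAt (fun b : V => b.2) (ContinuousLinearMap.snd ℂ (Fin 3 → ℂ) ℂ) a :=
    (ContinuousLinearMap.snd ℂ (Fin 3 → ℂ) ℂ).hasFDerivAt
  have h := (hw.pow 2).add (((((hx 0).pow 6).add ((hx 1).pow 6)).add ((hx 2).pow 6)).sub
    ((((((hx 0).pow 3).mul ((hx 1).pow 3)).add (((hx 0).pow 3).mul ((hx 2).pow 3))).add
      (((hx 1).pow 3).mul ((hx 2).pow 3))).const_mul 10))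
  have h' : HasFDerivAt F _ a := h
  rw [h'.fderiv]
  simp [dF]
  ring

/-- `X` is nonsingular: on the affine surface `vᵢ = 1`, `F = 0`, the differential of `F`
does not vanish on the directions `ξ` with `ξᵢ = 0`. -/
theorem exists_dF_ne_zero {i : Fin 3} {a : V} (hi : a.1 i = 1) (hF : F a = 0) :
    ∃ ξ : V, ξ.1 i = 0 ∧ dF a ξ ≠ 0 := by
  by_contra! H
  have h2 : a.2 = 0 := by
    have := H (0, 1) (by simp)
    simpa [dF] using this
  have hs (j : Fin 3) (hj : i ≠ j) := H (Pi.single j 1, 0) (by simp [hj])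
  have hj (j : Fin 3) : dF a (Pi.single j 1, 0) = 0 := by
    by_cases hij : i = j
    · subst hij
      have e : dF a (Pi.single 0 1, 0) * a.1 0 + dF a (Pi.single 1 1, 0) * a.1 1 +
          dF a (Pi.single 2 1, 0) * a.1 2 = 6 * F a := by
        simp [dF, F, Φ₆, h2]
        ring
      fin_cases i
      · simp at hi
        rw [hs 1 (by decide), hs 2 (by decide), hF, hi] at e
        simpa using e
      · simp at hi
        rw [hs 0 (by decide), hs 2 (by decide), hF, hi] at e
        simpa using e
      · simp at hi
        rw [hs 0 (by decide), hs 1 (by decide), hF, hi] at e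
        simpa using e
    · exact hs j hij
  have e0 := hj 0
  have e1 := hj 1
  have e2 := hj 2
  simp only [dF, h2, LinearMap.coe_mk, AddHom.coe_mk, Pi.single_apply] at e0 e1 e2
  simp only [Fin.reduceEq, if_true, if_false, mul_zero, zero_add, add_zero, mul_one]
    at e0 e1 e2
  obtain ⟨x, hx⟩ : ∃ x, x = a.1 0 ^ 3 := ⟨_, rfl⟩
  obtain ⟨y, hy⟩ : ∃ y, y = a.1 1 ^ 3 := ⟨_, rfl⟩
  obtain ⟨z, hz⟩ : ∃ z, z = a.1 2 ^ 3 := ⟨_, rfl⟩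
  have f0 : x * (x - 5 * (y + z)) = 0 := by
    rw [hx, hy, hz]; linear_combination (a.1 0 / 6) * e0
  have f1 : y * (y - 5 * (x + z)) = 0 := by
    rw [hx, hy, hz]; linear_combination (a.1 1 / 6) * e1
  have f2 : z * (z - 5 * (x + y)) = 0 := by
    rw [hx, hy, hz]; linear_combination (a.1 2 / 6) * e2
  have key : x = 0 ∧ y = 0 ∧ z = 0 := by
    rcases mul_eq_zero.1 f0 with f0 | f0 <;> rcases mul_eq_zero.1 f1 with f1 | f1 <;>
      rcases mul_eq_zero.1 f2 with f2 | f2 <;> refine ⟨?_, ?_, ?_⟩ <;> grind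
  obtain ⟨rfl, rfl, rfl⟩ := key
  fin_cases i
  · simp at hi
    simp [hi] at hx
  · simp at hi
    simp [hi] at hy
  · simp at hi
    simp [hi] at hz

theorem exists_chartData {i : Fin 3} {a : V} (hi : a.1 i = 1) (hF : F a = 0) :
    ∃ D : ChartData, D.i = i ∧ a ∈ D.Ψ.source := by
  obtain ⟨ξ, hξ, hd⟩ := exists_dF_ne_zero hi hF
  let L : V →ₗ[ℂ] ℂ × ℂ := ((LinearMap.proj i).comp (LinearMap.fst ℂ (Fin 3 → ℂ) ℂ)).prod (dF a)
  have hL (η : V) : L η = (η.1 i, dF a η) := rfl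
  have hsurj : LinearMap.range L = ⊤ := by
    rw [LinearMap.range_eq_top]
    rintro ⟨x, y⟩
    let η : V := (fun _ => x, 0)
    refine ⟨η + ((y - dF a η) / dF a ξ) • ξ, ?_⟩
    rw [hL]
    simp [hξ, hd, η]
  have hker : Module.finrank ℂ (LinearMap.ker L) = Module.finrank ℂ (ℂ × ℂ) := by
    have := L.finrank_range_add_finrank_ker
    rw [hsurj, finrank_top] at this
    simp at this ⊢
    omega
  obtain ⟨r, hr⟩ := (LinearMap.ker L).subtype.exists_leftInverse_of_injective
    (LinearMap.ker_eq_bot.2 (LinearMap.ker L).injective_subtype)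
  let e := LinearEquiv.ofFinrankEq _ _ hker
  let ℓ : V →L[ℂ] ℂ × ℂ := (e.toLinearMap ∘ₗ r).toContinuousLinearMap
  have hinj : Function.Injective (L.prod ℓ.toLinearMap) := by
    rw [injective_iff_map_eq_zero]
    intro η hη
    have h1 : L η = 0 := congrArg Prod.fst hη
    have h2 : e (r η) = 0 := congrArg Prod.snd hη
    have h3 : r η = 0 := by simpa using h2
    have h4 : r η = ⟨η, h1⟩ := LinearMap.congr_fun hr ⟨η, h1⟩
    rw [h4] at h3
    exact congrArg Subtype.val h3
  let E : V ≃L[ℂ] (ℂ × ℂ) × (ℂ × ℂ) :=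
    (LinearEquiv.ofInjectiveOfFinrankEq _ hinj (by simp)).toContinuousLinearEquiv
  have hder : HasFDerivAt (slice i ℓ) (E : V →L[ℂ] (ℂ × ℂ) × (ℂ × ℂ)) a := by
    have h1 : HasFDerivAt (fun b : V => b.1 i)
        ((ContinuousLinearMap.proj i).comp (ContinuousLinearMap.fst ℂ (Fin 3 → ℂ) ℂ)) a :=
      ((ContinuousLinearMap.proj i).comp (ContinuousLinearMap.fst ℂ (Fin 3 → ℂ) ℂ)).hasFDerivAt
    have h2 : HasFDerivAt F (fderiv ℂ F a) a :=
      (contDiff_F.differentiable (by simp)).differentiableAt.hasFDerivAt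
    have h3 := (h1.prodMk h2).prodMk ℓ.hasFDerivAt
    refine h3.congr_fderiv ?_
    refine ContinuousLinearMap.ext fun η => ?_
    refine Prod.ext (Prod.ext rfl ?_) rfl
    exact fderiv_F a η
  have hc := contDiff_slice i ℓ
  let Ψ₀ := hc.contDiffAt.toOpenPartialHomeomorph (slice i ℓ) hder (by simp)
  let S : Set V := {b | fderiv ℂ (slice i ℓ) b ∈
    Set.range ((↑) : (V ≃L[ℂ] (ℂ × ℂ) × (ℂ × ℂ)) → V →L[ℂ] (ℂ × ℂ) × (ℂ × ℂ))}
  have hS : IsOpen S :=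
    ContinuousLinearEquiv.isOpen.preimage (hc.continuous_fderiv (by simp))
  have hco : ∀ b, (Ψ₀.restrOpen S hS) b = slice i ℓ b := fun b => rfl
  refine ⟨⟨i, ℓ, Ψ₀.restrOpen S hS, hco, ?_⟩, rfl, ?_⟩
  · intro t ht
    obtain ⟨E', hE'⟩ := ((Ψ₀.restrOpen S hS).map_target ht).2
    refine (OpenPartialHomeomorph.contDiffAt_symm (f₀' := E') _ ht ?_ ?_).contDiffWithinAt
    · rw [hE']
      exact (hc.differentiable (by simp)).differentiableAt.hasFDerivAt
    · exact hc.contDiffAt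
  · exact ⟨hc.contDiffAt.mem_toOpenPartialHomeomorph_source hder (by simp), E, hder.fderiv.symm⟩

theorem exists_chart (p : X) : ∃ D : ChartData, p ∈ D.chart.source := by
  induction p using X.ind with
  | h a ha hF =>
    obtain ⟨i, hi⟩ := Function.ne_iff.1 (fst_ne_zero ha hF)
    obtain ⟨D, rfl, hD⟩ := exists_chartData (normalize_apply hi) (F_normalize hF)
    exact ⟨D, (D.mk_mem_source a ha hF).2 ⟨hi, hD⟩⟩

instance : ChartedSpace (ℂ × ℂ) X where
  atlas := Set.range ChartData.chart
  chartAt p := (exists_chart p).choose.chart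
  mem_chart_source p := (exists_chart p).choose_spec
  chart_mem_atlas _ := ⟨_, rfl⟩

/-- `X` is a complex surface. -/
instance : IsManifold (modelWithCornersSelf ℂ (ℂ × ℂ)) ω X := by
  refine isManifold_of_contDiffOn _ _ _ ?_
  rintro _ _ ⟨D, rfl⟩ ⟨D', rfl⟩
  simp only [modelWithCornersSelf_coe, modelWithCornersSelf_coe_symm, Set.range_id, Set.inter_univ,
    Set.preimage_id, Function.comp_id, Function.id_comp]
  have hsub : ∀ s ∈ (D.chart.symm ≫ₕ D'.chart).source, s ∈ D.dom ∧ (D.lift s).1 D'.i ≠ 0 := by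
    intro s hs
    rw [OpenPartialHomeomorph.trans_source] at hs
    have h1 : s ∈ D.dom := hs.1
    have h2 : D.chart.symm s ∈ D'.chart.source := hs.2
    rw [D.chart_symm_apply h1, D'.mk_mem_source] at h2
    exact ⟨h1, h2.1⟩
  have h : ContDiffOn ℂ ω (fun s => D'.ℓ (normalize D'.i (D.lift s)))
      (D.chart.symm ≫ₕ D'.chart).source :=
    D'.ℓ.contDiff.comp_contDiffOn ((contDiffOn_normalize D'.i).comp
      (D.contDiffOn_lift.mono fun s hs => (hsub s hs).1) fun s hs => (hsub s hs).2)
  refine h.congr fun s hs => ?_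
  change D'.chart (D.chart.symm s) = _
  rw [D.chart_symm_apply (hsub s hs).1, D'.chart_mk]

end HessianK3

end

noncomputable section

namespace Hessian

/-! ### Relations between the generators -/

/-! The group. A linear map preserving the pencil sends xyz to a member of the pencil that is again
a triangle. `triangle_of_pencil` looks at a vertex of that triangle, where the cubic is singular,
and finds that the only other triangles are, up to scale, x³ + y³ + z³ - 3ε^j xyz. These are the
pullbacks of xyz under `M₃ * M₄ ^ (2 * j)`, so modulo the generators the map preserves xyz itself.
It is then a monomial matrix, and the monomial matrices preserving the pencil are products of
scalars, cyclic permutations, the swap `M₃ ^ 2 / 3` and powers of `M₂`, `M₄`. This gives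
`hessianGroup_eq`: the Hessian group is `Γ ⊔ SL23`. Explicit relations show that `g₃` and its
conjugate under `g₄` generate a quaternion group normalized by `SL23`, with quotient generated by
the image of `g₄`, of order dividing 3. It is therefore the only Sylow 2-subgroup of `SL23`. As
`SL23` normalizes it and `Γ`, it normalizes the subgroup they generate.

The 2-forms. The weights 1, 1, 1, 3 add up to 6, the degree of F, so the residue of the contracted
volume form divided by F is a holomorphic 2-form on X without zeros. Any other holomorphic 2-form is
a holomorphic function times it, and that function is constant because X is compact and connected.

The lift. Suppose Φ₆(Av) = c Φ₆(v). On all generators c³ = det(A)⁶, so c² / det(A)³ is a square root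
of c. It is multiplicative in A and equals u³ on the scalar u. Hence (v, w) ↦ (Av, c² / det(A)³ · w)
acts on X, scalars act trivially, and the action descends to the Hessian group. It is faithful
because it already is on the plane. The residue form is multiplied by c / det(A)²
(`pullback_residueForm`), and c = det(A)² holds on the generators of `Γ` and of the quaternion
group. -/

theorem ε_sq : ε ^ 2 = -1 - ε := by
  have h : (ε - 1) * (ε ^ 2 + ε + 1) = 0 := by linear_combination ε_prim.pow_eq_one
  linear_combination (mul_eq_zero.1 h).resolve_left
    (sub_ne_zero.2 (ε_prim.ne_one (by norm_num)))

/-- Reduces every relation in PGL to a matrix identity with an explicit scalar, which is nonzero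
because A is invertible. -/
theorem projOf_eq_projOf {A B : Matrix (Fin 3) (Fin 3) ℂ} (hA : A.det ≠ 0) (hB : B.det ≠ 0)
    (c : ℂ) (h : A = c • B) : projOf A hA = projOf B hB := by
  have hc : c ≠ 0 := by
    rintro rfl
    simp [h] at hA
  refine (Matrix.ProjGenLinGroup.mk_eq_mk_iff.2 ⟨Units.mk0 c hc, ?_⟩).symm
  refine Units.ext ?_
  change B * Matrix.scalar (Fin 3) c = A
  rw [h, Matrix.scalar_apply, ← Matrix.smul_one_eq_diagonal, mul_smul_comm, mul_one]

theorem projOf_mul {A B : Matrix (Fin 3) (Fin 3) ℂ} (hA : A.det ≠ 0) (hB : B.det ≠ 0) :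
    projOf A hA * projOf B hB =
      projOf (A * B) (by rw [Matrix.det_mul]; exact mul_ne_zero hA hB) := by
  rw [projOf, projOf, ← map_mul]
  exact congrArg _ (Units.ext rfl)

theorem projOf_pow {A : Matrix (Fin 3) (Fin 3) ℂ} (hA : A.det ≠ 0) (n : ℕ) :
    projOf A hA ^ n = projOf (A ^ n) (by rw [Matrix.det_pow]; exact pow_ne_zero n hA) := by
  rw [projOf, ← map_pow]
  exact congrArg _ (Units.ext rfl)

theorem projOf_one : projOf 1 (by simp) = 1 := by
  rw [projOf, ← map_one Matrix.ProjGenLinGroup.mk]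
  exact congrArg _ (Units.ext rfl)

theorem m₁_pow_three : m₁ ^ 3 = 1 := by
  ext i j
  fin_cases i <;> fin_cases j <;>
    simp [m₁, pow_succ, Matrix.mul_apply, Fin.sum_univ_three]

theorem m₂_pow_three : m₂ ^ 3 = 1 := by
  have := ε_sq
  ext i j
  fin_cases i <;> fin_cases j <;>
    simp [m₂, pow_succ, Matrix.mul_apply, Fin.sum_univ_three] <;> grind

theorem m₄_pow_three : m₄ ^ 3 = 1 := by
  have := ε_sq
  ext i j
  fin_cases i <;> fin_cases j <;>
    simp [m₄, pow_succ, Matrix.mul_apply, Fin.sum_univ_three] <;> grind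

theorem m₃_sq : m₃ ^ 2 = (3 : ℂ) • !![1, 0, 0; 0, 0, 1; 0, 1, 0] := by
  have := ε_sq
  ext i j
  fin_cases i <;> fin_cases j <;>
    simp [m₃, pow_succ, Matrix.mul_apply, Fin.sum_univ_three] <;> grind

theorem m₃_pow_four : m₃ ^ 4 = (9 : ℂ) • 1 := by
  rw [show 4 = 2 + 2 from rfl, pow_add, m₃_sq]
  ext i j
  fin_cases i <;> fin_cases j <;>
    simp [Matrix.mul_apply, Fin.sum_univ_three]
  all_goals norm_num

theorem g₁_pow_three : g₁ ^ 3 = 1 := by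
  rw [g₁, projOf_pow, ← projOf_one]
  exact projOf_eq_projOf _ _ 1 (by rw [m₁_pow_three, one_smul])

theorem g₂_pow_three : g₂ ^ 3 = 1 := by
  rw [g₂, projOf_pow, ← projOf_one]
  exact projOf_eq_projOf _ _ 1 (by rw [m₂_pow_three, one_smul])

theorem g₄_pow_three : g₄ ^ 3 = 1 := by
  rw [g₄, projOf_pow, ← projOf_one]
  exact projOf_eq_projOf _ _ 1 (by rw [m₄_pow_three, one_smul])

theorem g₃_pow_four : g₃ ^ 4 = 1 := by
  rw [g₃, projOf_pow, ← projOf_one]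
  exact projOf_eq_projOf _ _ 9 m₃_pow_four

/-- The matrices commute only up to the scalar ε: they generate a Heisenberg group, which becomes
abelian in PGL. -/
theorem g₁_mul_g₂ : g₁ * g₂ = g₂ * g₁ := by
  rw [g₁, g₂, projOf_mul, projOf_mul]
  refine projOf_eq_projOf _ _ ε ?_
  have := ε_sq
  ext i j
  fin_cases i <;> fin_cases j <;>
    simp [m₁, m₂, Matrix.mul_apply, Fin.sum_univ_three] <;> grind

theorem g₃_mul_g₁ : g₃ * g₁ = g₂ ^ 2 * g₃ := by
  rw [g₁, g₂, g₃, projOf_pow, projOf_mul, projOf_mul]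
  refine projOf_eq_projOf _ _ 1 ?_
  have := ε_sq
  ext i j
  fin_cases i <;> fin_cases j <;>
    simp [m₁, m₂, m₃, pow_succ, Matrix.mul_apply, Fin.sum_univ_three] <;> grind

theorem g₃_mul_g₂ : g₃ * g₂ = g₁ * g₃ := by
  rw [g₁, g₂, g₃, projOf_mul, projOf_mul]
  refine projOf_eq_projOf _ _ 1 ?_
  have := ε_sq
  ext i j
  fin_cases i <;> fin_cases j <;>
    simp [m₁, m₂, m₃, Matrix.mul_apply, Fin.sum_univ_three] <;> grind

theorem g₄_mul_g₁ : g₄ * g₁ = g₂ * g₁ * g₄ := by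
  rw [g₁, g₂, g₄, projOf_mul, projOf_mul, projOf_mul]
  refine projOf_eq_projOf _ _ (ε ^ 2) ?_
  have := ε_sq
  ext i j
  fin_cases i <;> fin_cases j <;>
    simp [m₁, m₂, m₄, Matrix.mul_apply, Fin.sum_univ_three] <;> grind

theorem g₄_mul_g₂ : g₄ * g₂ = g₂ * g₄ := by
  rw [g₂, g₄, projOf_mul, projOf_mul]
  refine projOf_eq_projOf _ _ 1 ?_
  ext i j
  fin_cases i <;> fin_cases j <;>
    simp [m₂, m₄, Matrix.mul_apply, Fin.sum_univ_three]
  all_goals ring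

theorem g₄_mul_g₃_sq : g₄ * g₃ ^ 2 = g₃ ^ 2 * g₄ := by
  rw [g₃, g₄, projOf_pow, projOf_mul, projOf_mul]
  refine projOf_eq_projOf _ _ 1 ?_
  rw [m₃_sq]
  ext i j
  fin_cases i <;> fin_cases j <;>
    simp [m₄, Matrix.mul_apply, Fin.sum_univ_three] <;> ring

theorem g₃_sq_ne_one : g₃ ^ 2 ≠ 1 := by
  intro h
  rw [g₃, projOf_pow, ← projOf_one] at h
  obtain ⟨u, hu⟩ := Matrix.ProjGenLinGroup.mk_eq_mk_iff.1 h
  have hu' : m₃ ^ 2 * Matrix.scalar (Fin 3) (u : ℂ) = 1 := congrArg Units.val hu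
  rw [m₃_sq] at hu'
  have := congrFun (congrFun hu' 1) 1
  simp [Matrix.mul_apply, Fin.sum_univ_three] at this

theorem g₄_inv : g₄⁻¹ = g₄ ^ 2 :=
  inv_eq_of_mul_eq_one_right (by rw [← pow_succ', g₄_pow_three])

/-- The conjugate `g₄ g₃ g₄⁻¹`, which together with `g₃` generates the quaternion group. -/
def g₅ : PGL(Fin 3, ℂ) := g₄ * g₃ * g₄⁻¹

theorem g₅_sq : g₅ ^ 2 = g₃ ^ 2 := by
  rw [g₅, conj_pow, g₄_mul_g₃_sq, mul_inv_cancel_right]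

theorem g₅_mul_g₃ : g₅ * g₃ = g₃ ^ 3 * g₅ := by
  rw [g₅, g₄_inv, g₃, g₄, projOf_pow, projOf_pow, projOf_mul, projOf_mul, projOf_mul, projOf_mul]
  -- Divided by s = ε - ε², where s² = -3, the matrix `m₃` has determinant 1 and satisfies the
  -- quaternion relation exactly. The left side contains `m₃` twice and the right side four times,
  -- so the scalar is s² / s⁴ = -1/3.
  refine projOf_eq_projOf _ _ (-1 / 3) ?_
  have := ε_sq
  rw [pow_succ m₃ 2, m₃_sq]
  ext i j
  fin_cases i <;> fin_cases j <;>
    simp [m₃, m₄, pow_succ, Matrix.mul_apply, Fin.sum_univ_three] <;> grind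

/-- Conjugation by `g₄` acts as i ↦ j ↦ ij on the quaternion generators `g₃`, `g₅`, hence normalizes
the group they generate. -/
theorem g₄_mul_g₅ : g₄ * g₅ * g₄⁻¹ = g₃ * g₅ := by
  have h : g₄ * g₅ * g₄⁻¹ = g₄ ^ 2 * g₃ * g₄ := by
    rw [g₅, eq_comm]
    have h4 : g₄ = g₄⁻¹ * g₄⁻¹ := by rw [g₄_inv, ← pow_add, pow_succ, g₄_pow_three, one_mul]
    calc g₄ ^ 2 * g₃ * g₄ = g₄ ^ 2 * g₃ * (g₄⁻¹ * g₄⁻¹) := by rw [← h4]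
      _ = _ := by simp only [pow_two, mul_assoc]
  rw [h, g₅, g₄_inv, g₃, g₄, projOf_pow, projOf_mul, projOf_mul, projOf_mul, projOf_mul, projOf_mul]
  -- Again 1 / s with s = ε - ε²: one factor `m₃` on the left against two on the right.
  refine projOf_eq_projOf _ _ ((ε ^ 2 - ε) / 3) ?_
  have := ε_sq
  ext i j
  fin_cases i <;> fin_cases j <;>
    simp [m₃, m₄, pow_succ, Matrix.mul_apply, Fin.sum_univ_three] <;> grind

end Hessian

/-! ### The subgroups `Γ`, `Q₈` and `H₇₂` -/

/-- Conjugation by g maps the closure into itself. Since g⁻¹ is a positive power of g, so does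
conjugation by g⁻¹, which turns the inclusion into an equivalence. -/
theorem Subgroup.mem_normalizer_closure_of_pow_eq_one {G : Type*} [Group G] {S : Set G} {g : G}
    {n : ℕ} (hn : n ≠ 0) (hg : g ^ n = 1)
    (h : ∀ s ∈ S, g * s * g⁻¹ ∈ Subgroup.closure S) :
    g ∈ Subgroup.normalizer (Subgroup.closure S : Set G) := by
  have h1 : ∀ x ∈ Subgroup.closure S, g * x * g⁻¹ ∈ Subgroup.closure S := by
    intro x hx
    have : (Subgroup.closure S).map (MulAut.conj g).toMonoidHom ≤ Subgroup.closure S := by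
      rw [MonoidHom.map_closure, Subgroup.closure_le]
      rintro _ ⟨s, hs, rfl⟩
      exact h s hs
    exact this ⟨x, hx, rfl⟩
  have h2 : ∀ k : ℕ, ∀ x ∈ Subgroup.closure S, g ^ k * x * (g ^ k)⁻¹ ∈ Subgroup.closure S := by
    intro k
    induction k with
    | zero => simp
    | succ k ih =>
      intro x hx
      have := h1 _ (ih x hx)
      rw [pow_succ', mul_inv_rev]
      simpa only [mul_assoc] using this
  rw [Subgroup.mem_normalizer_iff]
  refine fun x => ⟨h1 x, fun hx => ?_⟩
  have h3 := h2 (n - 1) _ hx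
  have h4 : g ^ (n - 1) * g = 1 := by rw [← pow_succ, Nat.sub_add_cancel (by omega), hg]
  have h5 : g ^ (n - 1) * (g * x * g⁻¹) * (g ^ (n - 1))⁻¹ =
      (g ^ (n - 1) * g) * x * (g ^ (n - 1) * g)⁻¹ := by group
  rw [h5, h4] at h3
  simpa using h3

/-- The homomorphism from the quaternion group of order 8 given by two elements that satisfy
its relations. -/
def QuaternionGroup.liftTwo {G : Type*} [Group G] (A B : G) (hA : A ^ 4 = 1) (hB : B ^ 2 = A ^ 2)
    (hBA : B * A = A ^ 3 * B) : QuaternionGroup 2 →* G :=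
  have h4 : (4 : ZMod 4) = 0 := by decide
  have hz : ∀ i j : ℕ, (i : ZMod 4) = j → A ^ i = A ^ j := by
    intro i j hij
    rw [ZMod.natCast_eq_natCast_iff'] at hij
    rw [← Nat.div_add_mod i 4, ← Nat.div_add_mod j 4, pow_add, pow_add, pow_mul, pow_mul, hA, hij,
      one_pow, one_pow]
  have hBp : ∀ i : ℕ, B * A ^ i = A ^ (3 * i) * B := by
    intro i
    induction i with
    | zero => simp
    | succ i ih => rw [pow_succ, ← mul_assoc, ih, mul_assoc, hBA, ← mul_assoc, ← pow_add, mul_add]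
  have hpB : ∀ i : ℕ, A ^ i * B = B * A ^ (3 * i) := by
    intro i
    -- Moving B past A multiplies the exponent by 3, and 9 = 1 modulo 4.
    rw [hBp, hz i (3 * (3 * i)) (by push_cast; linear_combination (-2 * (i : ZMod 4)) * h4)]
  have hv : ∀ i : ZMod 4, ((i.val : ℕ) : ZMod 4) = i := fun i => ZMod.natCast_zmod_val i
  { toFun := fun x => match x with
      | .a i => A ^ (i : ZMod 4).val
      | .xa i => B * A ^ (i : ZMod 4).val
    map_one' := by
      change A ^ (0 : ZMod 4).val = 1
      simp
    map_mul' := by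
      rintro (i | i) (j | j)
      · change A ^ (i + j : ZMod 4).val = A ^ (i : ZMod 4).val * A ^ (j : ZMod 4).val
        rw [← pow_add]
        exact hz _ _ (by push_cast; simp only [hv])
      · change B * A ^ (j - i : ZMod 4).val = A ^ (i : ZMod 4).val * (B * A ^ (j : ZMod 4).val)
        rw [← mul_assoc, hpB, mul_assoc, ← pow_add]
        congr 1
        refine hz _ _ ?_
        push_cast; simp only [hv]
        linear_combination (-(show ZMod 4 from i)) * h4
      · change B * A ^ (i + j : ZMod 4).val = B * A ^ (i : ZMod 4).val * A ^ (j : ZMod 4).val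
        rw [mul_assoc, ← pow_add]
        congr 1
        exact hz _ _ (by push_cast; simp only [hv])
      -- In `QuaternionGroup 2` the product of `xa i` and `xa j` is `a (2 + j - i)`. The summand 2
      -- corresponds to B² = A².
      · change A ^ (((2 : ℕ) : ZMod 4) + j - i : ZMod 4).val =
          B * A ^ (i : ZMod 4).val * (B * A ^ (j : ZMod 4).val)
        rw [mul_assoc, ← mul_assoc (A ^ _), hpB, mul_assoc B, ← mul_assoc B B, ← pow_two B, hB, ← pow_add,
          ← pow_add]
        refine hz _ _ ?_
        push_cast; simp only [hv]
        linear_combination (-(show ZMod 4 from i)) * h4 }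

namespace QuaternionGroup

variable {G : Type*} [Group G] {A B : G} (hA : A ^ 4 = 1) (hB : B ^ 2 = A ^ 2)
  (hBA : B * A = A ^ 3 * B)

theorem liftTwo_a_one : liftTwo A B hA hB hBA (.a 1) = A := pow_one A

theorem liftTwo_xa_zero : liftTwo A B hA hB hBA (.xa 0) = B := by
  change B * A ^ (0 : ZMod 4).val = B
  simp

theorem range_liftTwo : (liftTwo A B hA hB hBA).range = Subgroup.closure {A, B} := by
  apply le_antisymm
  · rintro _ ⟨x, rfl⟩
    have h1 : A ∈ Subgroup.closure {A, B} := Subgroup.subset_closure (by simp)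
    have h2 : B ∈ Subgroup.closure {A, B} := Subgroup.subset_closure (by simp)
    rcases x with i | i
    · exact pow_mem h1 _
    · exact mul_mem h2 (pow_mem h1 _)
  · rw [Subgroup.closure_le]
    rintro _ (rfl | rfl)
    · exact ⟨_, liftTwo_a_one hA hB hBA⟩
    · exact ⟨_, liftTwo_xa_zero hA hB hBA⟩

/-- Every nontrivial element is the central involution `a 2` or squares to it, so a nontrivial
kernel would contain `a 2`. -/
theorem liftTwo_injective (hA2 : A ^ 2 ≠ 1) : Function.Injective (liftTwo A B hA hB hBA) := by
  rw [injective_iff_map_eq_one]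
  intro x hx
  have h2 : liftTwo A B hA hB hBA (.a 2) ≠ 1 := hA2
  have key : ∀ x : QuaternionGroup 2, x = 1 ∨ x = .a 2 ∨ x * x = .a 2 := by decide
  rcases key x with h | h | h
  · exact h
  · exact absurd (h ▸ hx) h2
  · exact absurd (by rw [← h, map_mul, hx, one_mul]) h2

end QuaternionGroup

namespace Hessian

/-! ### Normality of `Γ` and uniqueness of the Sylow 2-subgroup of `SL23`. -/

theorem g₃_mem_normalizer_Γ : g₃ ∈ Subgroup.normalizer (Γ : Set PGL(Fin 3, ℂ)) := by
  have h1 : g₁ ∈ Γ := Subgroup.subset_closure (by simp)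
  have h2 : g₂ ∈ Γ := Subgroup.subset_closure (by simp)
  refine Subgroup.mem_normalizer_closure_of_pow_eq_one (by norm_num) g₃_pow_four ?_
  rintro _ (rfl | rfl)
  · rw [g₃_mul_g₁, mul_inv_cancel_right]
    exact pow_mem h2 2
  · rw [g₃_mul_g₂, mul_inv_cancel_right]
    exact h1

theorem g₄_mem_normalizer_Γ : g₄ ∈ Subgroup.normalizer (Γ : Set PGL(Fin 3, ℂ)) := by
  have h1 : g₁ ∈ Γ := Subgroup.subset_closure (by simp)
  have h2 : g₂ ∈ Γ := Subgroup.subset_closure (by simp)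
  refine Subgroup.mem_normalizer_closure_of_pow_eq_one (by norm_num) g₄_pow_three ?_
  rintro _ (rfl | rfl)
  · rw [g₄_mul_g₁, mul_inv_cancel_right]
    exact mul_mem h2 h1
  · rw [g₄_mul_g₂, mul_inv_cancel_right]
    exact h2

theorem SL23_le_normalizer_Γ : SL23 ≤ Subgroup.normalizer (Γ : Set PGL(Fin 3, ℂ)) := by
  rw [SL23, Subgroup.closure_le]
  rintro _ (rfl | rfl)
  · exact g₃_mem_normalizer_Γ
  · exact g₄_mem_normalizer_Γ

theorem pow_three_of_mem_Γ {x : PGL(Fin 3, ℂ)} (hx : x ∈ Γ) : x ^ 3 = 1 := by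
  have hc : ∀ y ∈ Γ, ∀ z ∈ Γ, y * z = z * y := by
    intro y hy z hz
    have := Subgroup.isMulCommutative_closure (k := {g₁, g₂}) (by
      rintro _ (rfl | rfl) _ (rfl | rfl)
      · rfl
      · exact g₁_mul_g₂
      · exact g₁_mul_g₂.symm
      · rfl)
    exact congrArg Subtype.val (this.is_comm.comm (⟨y, hy⟩ : Γ) ⟨z, hz⟩)
  induction hx using Subgroup.closure_induction with
  | mem x hx =>
    rcases hx with rfl | rfl
    · exact g₁_pow_three
    · exact g₂_pow_three
  | one => simp
  | mul x y hx hy h1 h2 => rw [Commute.mul_pow (hc x hx y hy), h1, h2, one_mul]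
  | inv x hx h => rw [inv_pow, h, inv_one]

/-- The subgroup `⟨g₃, g₄ g₃ g₄⁻¹⟩`, the only Sylow 2-subgroup of `SL23`. -/
def quaternion : Subgroup PGL(Fin 3, ℂ) := Subgroup.closure {g₃, g₅}

theorem quaternion_eq_range : quaternion =
    (QuaternionGroup.liftTwo g₃ g₅ g₃_pow_four g₅_sq g₅_mul_g₃).range :=
  (QuaternionGroup.range_liftTwo _ _ _).symm

/-- The isomorphism with the quaternion group of order 8. -/
def quaternionEquiv : QuaternionGroup 2 ≃* quaternion :=
  (MonoidHom.ofInjective (QuaternionGroup.liftTwo_injective g₃_pow_four g₅_sq g₅_mul_g₃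
    g₃_sq_ne_one)).trans (MulEquiv.subgroupCongr quaternion_eq_range.symm)

theorem pow_four_of_mem_quaternion {x : PGL(Fin 3, ℂ)} (hx : x ∈ quaternion) : x ^ 4 = 1 := by
  have key : ∀ y : QuaternionGroup 2, y ^ 4 = 1 := by decide
  rw [quaternion_eq_range] at hx
  obtain ⟨y, rfl⟩ := hx
  rw [← map_pow, key, map_one]

theorem quaternion_le_SL23 : quaternion ≤ SL23 := by
  have h3 : g₃ ∈ SL23 := Subgroup.subset_closure (by simp)
  have h4 : g₄ ∈ SL23 := Subgroup.subset_closure (by simp)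
  rw [quaternion, Subgroup.closure_le]
  rintro _ (rfl | rfl)
  · exact h3
  · exact mul_mem (mul_mem h4 h3) (inv_mem h4)

theorem SL23_le_normalizer_quaternion :
    SL23 ≤ Subgroup.normalizer (quaternion : Set PGL(Fin 3, ℂ)) := by
  have h3 : g₃ ∈ quaternion := Subgroup.subset_closure (by simp)
  have h5 : g₅ ∈ quaternion := Subgroup.subset_closure (by simp)
  rw [SL23, Subgroup.closure_le]
  rintro _ (rfl | rfl)
  · exact Subgroup.le_normalizer h3
  · refine Subgroup.mem_normalizer_closure_of_pow_eq_one (by norm_num) g₄_pow_three ?_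
    rintro _ (rfl | rfl)
    · exact h5
    · rw [g₄_mul_g₅]
      exact mul_mem h3 h5

/-- Modulo the normal subgroup `quaternion` the generator `g₃` dies, so the quotient is cyclic,
generated by the image of `g₄`, whose cube is 1. -/
theorem pow_three_mem_quaternion {x : PGL(Fin 3, ℂ)} (hx : x ∈ SL23) : x ^ 3 ∈ quaternion := by
  let N := quaternion.subgroupOf SL23
  have hN : N.Normal := Subgroup.normal_subgroupOf_of_le_normalizer SL23_le_normalizer_quaternion
  have hk : ∀ y, QuotientGroup.mk' N y = 1 ↔ y ∈ N := fun y => by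
    rw [← MonoidHom.mem_ker, QuotientGroup.ker_mk']
  let G₄ : SL23 := ⟨g₄, Subgroup.subset_closure (by simp)⟩
  have key : ∀ y (hy : y ∈ SL23),
      QuotientGroup.mk' N ⟨y, hy⟩ ∈ Subgroup.zpowers (QuotientGroup.mk' N G₄) := by
    intro y hy
    induction hy using Subgroup.closure_induction with
    | mem y hy =>
      rcases hy with rfl | rfl
      · have h3 : g₃ ∈ quaternion := Subgroup.subset_closure (by simp)
        exact ((hk ⟨g₃, _⟩).2 h3).symm ▸ one_mem _
      · exact Subgroup.mem_zpowers _
    | one => exact one_mem _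
    | mul y z hy hz h1 h2 => exact mul_mem h1 h2
    | inv y hy h => exact inv_mem h
  obtain ⟨n, hn⟩ := key x hx
  have h4 : G₄ ^ 3 = 1 := Subtype.ext g₄_pow_three
  have : QuotientGroup.mk' N (⟨x, hx⟩ ^ 3) = 1 := by
    rw [map_pow, ← hn]
    change (QuotientGroup.mk' N G₄ ^ n) ^ 3 = 1
    rw [← zpow_natCast, zpow_comm, zpow_natCast, ← map_pow, h4, map_one, one_zpow]
  exact (hk _).1 this

/-- A normal 2-subgroup lies in every Sylow 2-subgroup. Conversely, if x has order 2^k then x³ lies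
in `quaternion`, and Bézout for 2^k and 3 puts x itself there. -/
theorem Q8_eq_quaternion (Q : Sylow 2 SL23) : Q8 Q = quaternion := by
  let N := quaternion.subgroupOf SL23
  have hN : N.Normal := Subgroup.normal_subgroupOf_of_le_normalizer SL23_le_normalizer_quaternion
  have hp : IsPGroup 2 N := fun x => ⟨2, Subtype.ext (Subtype.ext (pow_four_of_mem_quaternion x.2))⟩
  have hQ : (Q : Subgroup SL23) = N := by
    apply le_antisymm
    · intro x hx
      obtain ⟨k, hk⟩ := Q.isPGroup' ⟨x, hx⟩
      have hk' : x ^ 2 ^ k = 1 := congrArg Subtype.val hk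
      have h3 : x ^ 3 ∈ N := pow_three_mem_quaternion x.2
      have h2 : x ^ 2 ^ k ∈ N := hk' ▸ one_mem N
      have hc : IsCoprime ((2 ^ k : ℕ) : ℤ) ((3 : ℕ) : ℤ) :=
        Nat.isCoprime_iff_coprime.2 (Nat.Coprime.pow_left k (by norm_num))
      obtain ⟨u, v, huv⟩ := hc
      have : x = (x ^ 2 ^ k) ^ u * (x ^ 3) ^ v := by
        rw [← zpow_natCast, ← zpow_natCast, ← zpow_mul, ← zpow_mul, ← zpow_add, mul_comm _ u,
          mul_comm _ v, huv, zpow_one]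
      rw [this]
      exact mul_mem (zpow_mem h2 u) (zpow_mem h3 v)
    · exact hp.le_sylow_of_normal Q
  rw [Q8, hQ, Subgroup.map_subgroupOf_eq_of_le quaternion_le_SL23]

theorem disjoint_Γ_quaternion : Disjoint Γ quaternion := by
  rw [Subgroup.disjoint_def]
  intro x h1 h2
  have h3 := pow_three_of_mem_Γ h1
  have h4 := pow_four_of_mem_quaternion h2
  rwa [pow_succ, h3, one_mul] at h4

/-- The whole group generated by `Γ` and `SL23` normalizes `H₇₂`. -/
theorem le_normalizer_H72 (Q : Sylow 2 SL23) :
    Γ ⊔ SL23 ≤ Subgroup.normalizer (H72 Q : Set PGL(Fin 3, ℂ)) := by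
  rw [H72, Q8_eq_quaternion]
  refine sup_le (le_sup_left.trans Subgroup.le_normalizer) ?_
  rw [Subgroup.le_normalizer_iff]
  intro h hh
  suffices h' : (Γ ⊔ quaternion).map (MulAut.conj h).toMonoidHom ≤ Γ ⊔ quaternion from
    fun k hk => h' ⟨k, hk, rfl⟩
  rw [Subgroup.map_sup]
  refine sup_le_sup ?_ ?_
  · rintro _ ⟨k, hk, rfl⟩
    exact Subgroup.le_normalizer_iff.1 SL23_le_normalizer_Γ h hh k hk
  · rintro _ ⟨k, hk, rfl⟩
    exact Subgroup.le_normalizer_iff.1 SL23_le_normalizer_quaternion h hh k hk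

theorem H72_le (Q : Sylow 2 SL23) : H72 Q ≤ Γ ⊔ SL23 := by
  rw [H72, Q8_eq_quaternion]
  exact sup_le_sup le_rfl quaternion_le_SL23

theorem normal_Γ_subgroupOf_H72 (Q : Sylow 2 SL23) : (Γ.subgroupOf (H72 Q)).Normal :=
  Subgroup.normal_subgroupOf_of_le_normalizer
    ((H72_le Q).trans (sup_le Subgroup.le_normalizer SL23_le_normalizer_Γ))

end Hessian

/-! ### The linear stabilizer of the Hesse pencil -/

namespace Hessian

open Matrix

def cubeSum (v : Fin 3 → ℂ) : ℂ := v 0 ^ 3 + v 1 ^ 3 + v 2 ^ 3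

def coordProd (v : Fin 3 → ℂ) : ℂ := v 0 * v 1 * v 2

theorem linSubst_injective (A : GL (Fin 3) ℂ) : Function.Injective (linSubst A.val) := by
  have h : linSubst A⁻¹.val ∘ₗ linSubst A.val = LinearMap.id := by
    rw [← linSubst_mul, ← Units.val_mul, mul_inv_cancel, Units.val_one, linSubst_one]
  exact Function.LeftInverse.injective (g := linSubst A⁻¹.val) (LinearMap.congr_fun h)

theorem eval_linSubst (A : Matrix (Fin 3) (Fin 3) ℂ) (f : MvPolynomial (Fin 3) ℂ)
    (v : Fin 3 → ℂ) :
    MvPolynomial.eval v (linSubst A f) = MvPolynomial.eval (A *ᵥ v) f := by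
  change MvPolynomial.eval v (MvPolynomial.bind₁ A.toMvPolynomial f) = _
  rw [MvPolynomial.eval, MvPolynomial.eval₂Hom_bind₁]
  congr 2
  funext i
  exact A.toMvPolynomial_eval_eq_apply i v

/-- Over an infinite field a polynomial is determined by its values, so the pencil can be handled
through functions on ℂ³ from here on. -/
theorem linSubst_mem_hessePencil {A : Matrix (Fin 3) (Fin 3) ℂ} {f : MvPolynomial (Fin 3) ℂ} :
    linSubst A f ∈ hessePencil ↔ ∃ a b : ℂ, ∀ v : Fin 3 → ℂ,
      MvPolynomial.eval (A *ᵥ v) f = a * cubeSum v + b * coordProd v := by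
  rw [hessePencil, Submodule.mem_span_pair]
  refine exists_congr fun a => exists_congr fun b => ⟨fun h v => ?_, fun h => ?_⟩
  · rw [← eval_linSubst, ← h]
    simp [cubeSum, coordProd, mul_add]
  · refine MvPolynomial.funext fun v => ?_
    rw [eval_linSubst, h]
    simp [cubeSum, coordProd, mul_add]

/-- The substitution is injective and the pencil finite-dimensional, so mapping the two spanning
cubics into the pencil already forces equality. -/
theorem mem_linearStabilizer {A : GL (Fin 3) ℂ} : A ∈ linearStabilizer ↔
    (∃ a b : ℂ, ∀ v : Fin 3 → ℂ, cubeSum (A.val *ᵥ v) = a * cubeSum v + b * coordProd v) ∧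
    (∃ a b : ℂ, ∀ v : Fin 3 → ℂ, coordProd (A.val *ᵥ v) = a * cubeSum v + b * coordProd v) := by
  have h1 := linSubst_mem_hessePencil (A := A.val)
    (f := MvPolynomial.X 0 ^ 3 + MvPolynomial.X 1 ^ 3 + MvPolynomial.X 2 ^ 3)
  have h2 := linSubst_mem_hessePencil (A := A.val)
    (f := MvPolynomial.X 0 * MvPolynomial.X 1 * MvPolynomial.X 2)
  simp only [map_add, map_pow, map_mul, MvPolynomial.eval_X] at h1 h2
  unfold cubeSum coordProd at *
  rw [← h1, ← h2, ← map_add, ← map_add]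
  change hessePencil.map (linSubst A.val) = hessePencil ↔ _
  constructor
  · intro h
    constructor
    · exact h ▸ Submodule.mem_map_of_mem (Submodule.subset_span (by simp))
    · exact h ▸ Submodule.mem_map_of_mem (Submodule.subset_span (by simp))
  · rintro ⟨h1, h2⟩
    have : FiniteDimensional ℂ hessePencil :=
      FiniteDimensional.span_of_finite ℂ (Set.toFinite _)
    refine Submodule.eq_of_le_of_finrank_eq ?_
      (Submodule.equivMapOfInjective _ (linSubst_injective A) _).finrank_eq.symm
    rw [Submodule.map_le_iff_le_comap, hessePencil, Submodule.span_le]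
    rintro _ (rfl | rfl)
    · exact h1
    · exact h2

/-- The linear transformations given by `m₁`, …, `m₄`. -/
def M₁ : GL (Fin 3) ℂ := GeneralLinearGroup.mkOfDetNeZero m₁ det_m₁
def M₂ : GL (Fin 3) ℂ := GeneralLinearGroup.mkOfDetNeZero m₂ det_m₂
def M₃ : GL (Fin 3) ℂ := GeneralLinearGroup.mkOfDetNeZero m₃ det_m₃
def M₄ : GL (Fin 3) ℂ := GeneralLinearGroup.mkOfDetNeZero m₄ det_m₄

theorem m₁_mulVec (v : Fin 3 → ℂ) : m₁ *ᵥ v = ![v 1, v 2, v 0] := by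
  funext i
  fin_cases i <;> simp [m₁, Matrix.mulVec, dotProduct, Fin.sum_univ_three]

theorem m₂_mulVec (v : Fin 3 → ℂ) : m₂ *ᵥ v = ![v 0, ε * v 1, ε ^ 2 * v 2] := by
  funext i
  fin_cases i <;> simp [m₂, Matrix.mulVec, dotProduct, Fin.sum_univ_three]

theorem m₃_mulVec (v : Fin 3 → ℂ) : m₃ *ᵥ v = ![v 0 + v 1 + v 2, v 0 + ε * v 1 + ε ^ 2 * v 2,
    v 0 + ε ^ 2 * v 1 + ε * v 2] := by
  funext i
  fin_cases i <;> simp [m₃, Matrix.mulVec, dotProduct, Fin.sum_univ_three]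

theorem m₄_mulVec (v : Fin 3 → ℂ) : m₄ *ᵥ v = ![v 0, ε * v 1, ε * v 2] := by
  funext i
  fin_cases i <;> simp [m₄, Matrix.mulVec, dotProduct, Fin.sum_univ_three]

/-- The last two coordinates are exchanged by ε ↔ ε², so their product and sum are free of ε.
Symmetric expressions in them can then be expanded by `ring` alone. -/
theorem m₃_mulVec_two_mul_three (v : Fin 3 → ℂ) : (m₃ *ᵥ v) 1 * (m₃ *ᵥ v) 2 =
    v 0 ^ 2 + v 1 ^ 2 + v 2 ^ 2 - v 0 * v 1 - v 1 * v 2 - v 2 * v 0 := by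
  have := ε_sq
  simp only [m₃_mulVec, cons_val]
  grind

theorem m₃_mulVec_two_add_three (v : Fin 3 → ℂ) : (m₃ *ᵥ v) 1 + (m₃ *ᵥ v) 2 =
    2 * v 0 - v 1 - v 2 := by
  simp only [m₃_mulVec, cons_val]
  linear_combination (v 1 + v 2) * ε_sq

theorem m₃_mulVec_zero (v : Fin 3 → ℂ) : (m₃ *ᵥ v) 0 = v 0 + v 1 + v 2 := by
  simp [m₃_mulVec]

/-- The classical factorization of x³ + y³ + z³ - 3xyz, whose three factors are the rows of `m₃`. -/
theorem coordProd_m₃ (v : Fin 3 → ℂ) : coordProd (m₃ *ᵥ v) = cubeSum v - 3 * coordProd v := by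
  rw [coordProd, mul_assoc, m₃_mulVec_two_mul_three, m₃_mulVec_zero, cubeSum, coordProd]
  ring

theorem cubeSum_m₃ (v : Fin 3 → ℂ) : cubeSum (m₃ *ᵥ v) = 3 * cubeSum v + 18 * coordProd v := by
  have h1 := m₃_mulVec_two_mul_three v
  have h2 := m₃_mulVec_two_add_three v
  have h3 : (m₃ *ᵥ v) 1 ^ 3 + (m₃ *ᵥ v) 2 ^ 3 =
      ((m₃ *ᵥ v) 1 + (m₃ *ᵥ v) 2) ^ 3 -
        3 * ((m₃ *ᵥ v) 1 * (m₃ *ᵥ v) 2) * ((m₃ *ᵥ v) 1 + (m₃ *ᵥ v) 2) := by ring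
  rw [cubeSum, add_assoc, h3, h1, h2, m₃_mulVec_zero, cubeSum, coordProd]
  ring

theorem Φ₆_m₃ (v : Fin 3 → ℂ) : HessianK3.Φ₆ (m₃ *ᵥ v) = -27 * HessianK3.Φ₆ v := by
  have h1 := m₃_mulVec_two_mul_three v
  have h2 := m₃_mulVec_two_add_three v
  -- With s and p the sum and product of the last two coordinates y, z: y³ + z³ = s³ - 3ps and y⁶ +
  -- z⁶ - 10y³z³ = (y³ + z³)² - 12p³.
  have h3 (x : ℂ) : x ^ 6 + (m₃ *ᵥ v) 1 ^ 6 + (m₃ *ᵥ v) 2 ^ 6 - 10 * (x ^ 3 * (m₃ *ᵥ v) 1 ^ 3 +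
      x ^ 3 * (m₃ *ᵥ v) 2 ^ 3 + (m₃ *ᵥ v) 1 ^ 3 * (m₃ *ᵥ v) 2 ^ 3) =
      x ^ 6 + (((m₃ *ᵥ v) 1 + (m₃ *ᵥ v) 2) ^ 3 -
        3 * ((m₃ *ᵥ v) 1 * (m₃ *ᵥ v) 2) * ((m₃ *ᵥ v) 1 + (m₃ *ᵥ v) 2)) ^ 2 -
      12 * ((m₃ *ᵥ v) 1 * (m₃ *ᵥ v) 2) ^ 3 -
      10 * x ^ 3 * (((m₃ *ᵥ v) 1 + (m₃ *ᵥ v) 2) ^ 3 -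
        3 * ((m₃ *ᵥ v) 1 * (m₃ *ᵥ v) 2) * ((m₃ *ᵥ v) 1 + (m₃ *ᵥ v) 2)) := by ring
  rw [HessianK3.Φ₆, h3, h1, h2, m₃_mulVec_zero, HessianK3.Φ₆]
  ring

theorem ε_pow_three : ε ^ 3 = 1 := ε_prim.pow_eq_one

theorem M₁_mem_linearStabilizer : M₁ ∈ linearStabilizer := by
  refine mem_linearStabilizer.2 ⟨⟨1, 0, fun v => ?_⟩, ⟨0, 1, fun v => ?_⟩⟩
  · change cubeSum (m₁ *ᵥ v) = _
    simp only [m₁_mulVec, cubeSum, cons_val]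
    ring
  · change coordProd (m₁ *ᵥ v) = _
    simp only [m₁_mulVec, coordProd, cons_val]
    ring

theorem M₂_mem_linearStabilizer : M₂ ∈ linearStabilizer := by
  have := ε_pow_three
  refine mem_linearStabilizer.2 ⟨⟨1, 0, fun v => ?_⟩, ⟨0, 1, fun v => ?_⟩⟩
  · change cubeSum (m₂ *ᵥ v) = _
    simp only [m₂_mulVec, cubeSum, cons_val]
    grind
  · change coordProd (m₂ *ᵥ v) = _
    simp only [m₂_mulVec, coordProd, cons_val]
    grind

theorem M₃_mem_linearStabilizer : M₃ ∈ linearStabilizer :=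
  mem_linearStabilizer.2 ⟨⟨3, 18, cubeSum_m₃⟩, ⟨1, -3, fun v => by
    rw [one_mul, neg_mul, ← sub_eq_add_neg]; exact coordProd_m₃ v⟩⟩

theorem M₄_mem_linearStabilizer : M₄ ∈ linearStabilizer := by
  have := ε_pow_three
  refine mem_linearStabilizer.2 ⟨⟨1, 0, fun v => ?_⟩, ⟨0, ε ^ 2, fun v => ?_⟩⟩
  · change cubeSum (m₄ *ᵥ v) = _
    simp only [m₄_mulVec, cubeSum, cons_val]
    grind
  · change coordProd (m₄ *ᵥ v) = _
    simp only [m₄_mulVec, coordProd, cons_val]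
    ring

/-! ### The stabilizer of the pencil is generated by `M₁`, …, `M₄` and the scalars. -/

theorem Γ_sup_SL23_le {K : Subgroup PGL(Fin 3, ℂ)} (h1 : g₁ ∈ K) (h2 : g₂ ∈ K) (h3 : g₃ ∈ K)
    (h4 : g₄ ∈ K) : Γ ⊔ SL23 ≤ K := by
  rw [Γ, SL23]
  refine sup_le ((Subgroup.closure_le _).2 ?_) ((Subgroup.closure_le _).2 ?_)
  · rintro _ (rfl | rfl)
    exacts [h1, h2]
  · rintro _ (rfl | rfl)
    exacts [h3, h4]

theorem Γ_sup_SL23_le_hessianGroup : Γ ⊔ SL23 ≤ hessianGroup :=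
  Γ_sup_SL23_le ⟨M₁, M₁_mem_linearStabilizer, rfl⟩ ⟨M₂, M₂_mem_linearStabilizer, rfl⟩
    ⟨M₃, M₃_mem_linearStabilizer, rfl⟩ ⟨M₄, M₄_mem_linearStabilizer, rfl⟩

/-- The linear transformations that induce elements of `⟨Γ, SL23⟩`. -/
def generatedGL : Subgroup (GL (Fin 3) ℂ) := (Γ ⊔ SL23).comap ProjGenLinGroup.mk

theorem M₁_mem_generatedGL : M₁ ∈ generatedGL :=
  Subgroup.mem_sup_left (Subgroup.subset_closure (by simp) : g₁ ∈ Γ)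

theorem M₂_mem_generatedGL : M₂ ∈ generatedGL :=
  Subgroup.mem_sup_left (Subgroup.subset_closure (by simp) : g₂ ∈ Γ)

theorem M₃_mem_generatedGL : M₃ ∈ generatedGL :=
  Subgroup.mem_sup_right (Subgroup.subset_closure (by simp) : g₃ ∈ SL23)

theorem M₄_mem_generatedGL : M₄ ∈ generatedGL :=
  Subgroup.mem_sup_right (Subgroup.subset_closure (by simp) : g₄ ∈ SL23)

theorem scalar_mem_generatedGL (u : ℂˣ) : GeneralLinearGroup.scalar (Fin 3) u ∈ generatedGL := by
  rw [generatedGL, Subgroup.mem_comap, ProjGenLinGroup.mk_scalar]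
  exact one_mem _

theorem diagonal_mem_generatedGL {A : GL (Fin 3) ℂ} (hA : A ∈ linearStabilizer)
    {d : Fin 3 → ℂ} (hd : A.val = diagonal d) : A ∈ generatedGL := by
  obtain ⟨⟨a, b, hS⟩, -⟩ := mem_linearStabilizer.1 hA
  -- Evaluating at the unit vectors: all diagonal entries have the same cube, so they differ by
  -- powers of ε.
  have hd3 (i : Fin 3) : d i ^ 3 = a := by
    have := hS (Pi.single i 1)
    rw [hd] at this
    fin_cases i <;> simpa [cubeSum, coordProd, mulVec_diagonal] using this
  have hdet : A.val.det ≠ 0 := (Matrix.isUnits_det_units A).ne_zero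
  rw [hd, det_diagonal, Fin.prod_univ_three] at hdet
  have h0 : d 0 ≠ 0 := fun h => hdet (by simp [h])
  have hq (i : Fin 3) : ∃ k : ℕ, d i = d 0 * ε ^ k := by
    obtain ⟨k, -, hk⟩ := ε_prim.eq_pow_of_pow_eq_one (ξ := d i / d 0) (by
      rw [div_pow, hd3, hd3, div_self (by rw [← hd3 0]; exact pow_ne_zero 3 h0)])
    exact ⟨k, by rw [hk]; field_simp⟩
  obtain ⟨i, hi⟩ := hq 1
  obtain ⟨j, hj⟩ := hq 2
  have h2 : m₂ = diagonal ![1, ε, ε ^ 2] := by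
    ext i j
    fin_cases i <;> fin_cases j <;> simp [m₂]
  have h4 : m₄ = diagonal ![1, ε, ε] := by
    ext i j
    fin_cases i <;> fin_cases j <;> simp [m₄]
  -- The exponents solve α + β ≡ i and 2α + β ≡ j modulo 3, for α the exponent of `M₂` and β that of
  -- `M₄`.
  have hAe : A = GeneralLinearGroup.scalar (Fin 3) (Units.mk0 (d 0) h0) *
      (M₂ ^ (j + 2 * i) * M₄ ^ (2 * i + 2 * j)) := by
    refine Units.ext ?_
    change A.val = scalar (Fin 3) (d 0) * (m₂ ^ (j + 2 * i) * m₄ ^ (2 * i + 2 * j))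
    rw [hd, h2, h4, diagonal_pow, diagonal_pow, diagonal_mul_diagonal, scalar_apply,
      diagonal_mul_diagonal]
    congr 1
    have e1 : ε ^ i = ε ^ i * (ε ^ 3) ^ (i + j) := by rw [ε_pow_three, one_pow, mul_one]
    have e2 : ε ^ j = ε ^ j * (ε ^ 3) ^ (2 * i + j) := by rw [ε_pow_three, one_pow, mul_one]
    funext k
    fin_cases k
    · simp
    · simp only [Fin.mk_one, hi, Pi.pow_apply, cons_val]
      rw [e1]
      ring
    · simp only [Fin.reduceFinMk, hj, Pi.pow_apply, cons_val]
      rw [e2]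
      ring
  rw [hAe]
  exact mul_mem (scalar_mem_generatedGL _)
    (mul_mem (pow_mem M₂_mem_generatedGL _) (pow_mem M₄_mem_generatedGL _))

/-- A linear transformation that preserves the triangle `xyz = 0`: for any two columns there is a
row with zeros in these columns. -/
theorem exists_row_eq_zero {A : Matrix (Fin 3) (Fin 3) ℂ} {b : ℂ}
    (h : ∀ v, coordProd (A *ᵥ v) = b * coordProd v) (j k l : Fin 3) (hj : l ≠ j) (hk : l ≠ k) :
    ∃ i, A i j = 0 ∧ A i k = 0 := by
  -- The point e_j + t e_k lies on the side v_l = 0 of the triangle, so some row of A vanishes at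
  -- it. With four values of t and three rows, one row vanishes for two values of t, hence on both
  -- e_j and e_k.
  have hz (t : Fin 4) : ∃ i, A i j + (t : ℕ) * A i k = 0 := by
    have h3 (w : Fin 3 → ℂ) : coordProd w = ∏ i, w i := (Fin.prod_univ_three _).symm
    have h1 := h (Pi.single j 1 + Pi.single k ((t : ℕ) : ℂ))
    have h2 : coordProd (Pi.single j 1 + Pi.single k ((t : ℕ) : ℂ)) = 0 := by
      rw [h3]
      exact Finset.prod_eq_zero (Finset.mem_univ l) (by simp [hj, hk])
    rw [h2, mul_zero, h3, Finset.prod_eq_zero_iff] at h1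
    obtain ⟨i, -, hi⟩ := h1
    refine ⟨i, ?_⟩
    rw [mulVec_add] at hi
    simpa [mulVec_single, mul_comm] using hi
  choose f hf using hz
  obtain ⟨t, t', htt, hft⟩ := Fintype.exists_ne_map_eq_of_card_lt f (by simp)
  have h1 := hf t
  have h2 := hf t'
  rw [← hft] at h2
  have hne : (((t : ℕ) : ℂ) - (t' : ℕ)) ≠ 0 := by
    rw [sub_ne_zero]
    exact fun h => htt (Fin.ext (Nat.cast_injective h))
  have hk0 : A (f t) k = 0 := by
    refine (mul_eq_zero.1 ?_).resolve_left hne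
    linear_combination h1 - h2
  exact ⟨f t, by simpa [hk0] using h1, hk0⟩

/-- The permutation matrix of `(x, y, z) ↦ (x, z, y)`. -/
def swapGL : GL (Fin 3) ℂ :=
  GeneralLinearGroup.mkOfDetNeZero !![1, 0, 0; 0, 0, 1; 0, 1, 0] (by simp [det_fin_three])

theorem swapGL_eq :
    swapGL = GeneralLinearGroup.scalar (Fin 3) (Units.mk0 3 (by norm_num))⁻¹ * M₃ ^ 2 := by
  rw [map_inv, eq_inv_mul_iff_mul_eq]
  refine Units.ext ?_
  change scalar (Fin 3) (3 : ℂ) * !![1, 0, 0; 0, 0, 1; 0, 1, 0] = m₃ ^ 2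
  rw [m₃_sq, scalar_apply, ← smul_one_eq_diagonal, smul_mul_assoc, one_mul]

theorem swapGL_mem_generatedGL : swapGL ∈ generatedGL := by
  rw [swapGL_eq]
  exact mul_mem (scalar_mem_generatedGL _) (pow_mem M₃_mem_generatedGL 2)

theorem generatedGL_le_linearStabilizer : generatedGL ≤ linearStabilizer := by
  intro A hA
  obtain ⟨B, hB, hBA⟩ := Γ_sup_SL23_le_hessianGroup hA
  obtain ⟨u, rfl⟩ := ProjGenLinGroup.mk_eq_mk_iff.1 hBA
  refine mul_mem hB (mem_linearStabilizer.2
    ⟨⟨(u : ℂ) ^ 3, 0, fun v => ?_⟩, ⟨0, (u : ℂ) ^ 3, fun v => ?_⟩⟩)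
  · rw [GeneralLinearGroup.coe_scalar, scalar_apply, ← smul_one_eq_diagonal, smul_mulVec,
      one_mulVec]
    simp only [cubeSum, Pi.smul_apply, smul_eq_mul]
    ring
  · rw [GeneralLinearGroup.coe_scalar, scalar_apply, ← smul_one_eq_diagonal, smul_mulVec,
      one_mulVec]
    simp only [coordProd, Pi.smul_apply, smul_eq_mul]
    ring

theorem coordProd_M₁ (v : Fin 3 → ℂ) : coordProd (M₁.val *ᵥ v) = coordProd v := by
  change coordProd (m₁ *ᵥ v) = _
  simp only [m₁_mulVec, coordProd, cons_val]
  ring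

theorem coordProd_swapGL (v : Fin 3 → ℂ) : coordProd (swapGL.val *ᵥ v) = coordProd v := by
  change coordProd (!![1, 0, 0; 0, 0, 1; 0, 1, 0] *ᵥ v) = _
  simp [coordProd, mulVec, dotProduct, Fin.sum_univ_three]
  ring

theorem exists_ne_zero (A : GL (Fin 3) ℂ) (i : Fin 3) : ¬ (A.val i 0 = 0 ∧ A.val i 1 = 0 ∧
    A.val i 2 = 0) := by
  rintro ⟨h0, h1, h2⟩
  refine (Matrix.isUnits_det_units A).ne_zero (det_eq_zero_of_row_eq_zero i fun j => ?_)
  fin_cases j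
  exacts [h0, h1, h2]

/-- The linear transformations that preserve the pencil and the triangle `xyz = 0`. -/
theorem mem_generatedGL_of_coordProd {A : GL (Fin 3) ℂ} (hA : A ∈ linearStabilizer) {b : ℂ}
    (h : ∀ v, coordProd (A.val *ᵥ v) = b * coordProd v) : A ∈ generatedGL := by
  -- Every pair of columns has a row that vanishes on it, so A is monomial. Left multiplication by
  -- `M₁` and `swapGL` permutes the rows until A is diagonal.
  have step1 (A : GL (Fin 3) ℂ) (hA : A ∈ linearStabilizer)
      (h : ∀ v, coordProd (A.val *ᵥ v) = b * coordProd v) (h01 : A.val 0 1 = 0)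
      (h02 : A.val 0 2 = 0) (h10 : A.val 1 0 = 0) (h12 : A.val 1 2 = 0) : A ∈ generatedGL := by
    obtain ⟨i, hi0, hi1⟩ := exists_row_eq_zero h 0 1 2 (by decide) (by decide)
    have h0 := exists_ne_zero A 0
    have h1 := exists_ne_zero A 1
    have h2 : A.val 2 0 = 0 ∧ A.val 2 1 = 0 := by
      fin_cases i
      · exact absurd ⟨hi0, hi1, h02⟩ h0
      · exact absurd ⟨hi0, hi1, h12⟩ h1
      · exact ⟨hi0, hi1⟩
    refine diagonal_mem_generatedGL hA (d := fun i => A.val i i) ?_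
    ext i j
    fin_cases i <;> fin_cases j <;> simp [h01, h02, h10, h12, h2.1, h2.2]
  have step2 (A : GL (Fin 3) ℂ) (hA : A ∈ linearStabilizer)
      (h : ∀ v, coordProd (A.val *ᵥ v) = b * coordProd v) (h01 : A.val 0 1 = 0)
      (h02 : A.val 0 2 = 0) : A ∈ generatedGL := by
    obtain ⟨i, hi0, hi2⟩ := exists_row_eq_zero h 0 2 1 (by decide) (by decide)
    have h0 := exists_ne_zero A 0
    fin_cases i
    · exact absurd ⟨hi0, h01, hi2⟩ h0
    · exact step1 A hA h h01 h02 hi0 hi2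
    · have hs (j : Fin 3) : (swapGL * A).val 0 j = A.val 0 j ∧
          (swapGL * A).val 1 j = A.val 2 j := by
        constructor
        · change ((!![1, 0, 0; 0, 0, 1; 0, 1, 0] : Matrix (Fin 3) (Fin 3) ℂ) * A.val) 0 j = _
          simp [mul_apply, Fin.sum_univ_three]
        · change ((!![1, 0, 0; 0, 0, 1; 0, 1, 0] : Matrix (Fin 3) (Fin 3) ℂ) * A.val) 1 j = _
          simp [mul_apply, Fin.sum_univ_three]
      rw [← Subgroup.mul_mem_cancel_left _ swapGL_mem_generatedGL]
      refine step1 _ (mul_mem (generatedGL_le_linearStabilizer swapGL_mem_generatedGL) hA)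
        (fun v => ?_) ((hs 1).1.trans h01) ((hs 2).1.trans h02) ((hs 0).2.trans hi0)
        ((hs 2).2.trans hi2)
      rw [Units.val_mul, ← mulVec_mulVec, coordProd_swapGL, h]
  have rot (A : GL (Fin 3) ℂ) (j : Fin 3) : (M₁ * A).val 0 j = A.val 1 j ∧
      (M₁ * A).val 1 j = A.val 2 j := by
    constructor
    · change (m₁ * A.val) 0 j = _
      simp [m₁, mul_apply, Fin.sum_univ_three]
    · change (m₁ * A.val) 1 j = _
      simp [m₁, mul_apply, Fin.sum_univ_three]
  have hrot (A : GL (Fin 3) ℂ) (h : ∀ v, coordProd (A.val *ᵥ v) = b * coordProd v)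
      (v : Fin 3 → ℂ) : coordProd ((M₁ * A).val *ᵥ v) = b * coordProd v := by
    rw [Units.val_mul, ← mulVec_mulVec, coordProd_M₁, h]
  obtain ⟨i, h1, h2⟩ := exists_row_eq_zero h 1 2 0 (by decide) (by decide)
  have hA' := mul_mem M₁_mem_linearStabilizer hA
  fin_cases i
  · exact step2 A hA h h1 h2
  · rw [← Subgroup.mul_mem_cancel_left _ M₁_mem_generatedGL]
    exact step2 _ hA' (hrot A h) ((rot A 1).1.trans h1) ((rot A 2).1.trans h2)
  · rw [← Subgroup.mul_mem_cancel_left _ M₁_mem_generatedGL,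
      ← Subgroup.mul_mem_cancel_left _ M₁_mem_generatedGL]
    exact step2 _ (mul_mem M₁_mem_linearStabilizer hA') (hrot _ (hrot A h))
      ((rot _ 1).1.trans ((rot A 1).2.trans h1)) ((rot _ 2).1.trans ((rot A 2).2.trans h2))

/-- A member `a (x³ + y³ + z³) + b xyz` of the pencil that is a product of three independent linear
forms. -/
theorem triangle_of_pencil {A : GL (Fin 3) ℂ} {a b : ℂ}
    (h : ∀ v, coordProd (A.val *ᵥ v) = a * cubeSum v + b * coordProd v) (ha : a ≠ 0) :
    b ^ 3 = -27 * a ^ 3 := by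
  obtain ⟨p, hp⟩ : ∃ p, p = A.val 0 := ⟨_, rfl⟩
  obtain ⟨q, hq⟩ : ∃ q, q = A.val 1 := ⟨_, rfl⟩
  obtain ⟨r, hr⟩ : ∃ r, r = A.val 2 := ⟨_, rfl⟩
  have hA (v : Fin 3 → ℂ) : coordProd (A.val *ᵥ v) = (p 0 * v 0 + p 1 * v 1 + p 2 * v 2) *
      (q 0 * v 0 + q 1 * v 1 + q 2 * v 2) * (r 0 * v 0 + r 1 * v 1 + r 2 * v 2) := by
    simp only [coordProd, mulVec, dotProduct, Fin.sum_univ_three, hp, hq, hr]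
  -- The cross product of the first two rows is the vertex where the lines p and q meet. Two of the
  -- three factors vanish there, so the cubic has zero gradient, which is what `key` expresses.
  obtain ⟨x, hx⟩ : ∃ x, x = p 1 * q 2 - p 2 * q 1 := ⟨_, rfl⟩
  obtain ⟨y, hy⟩ : ∃ y, y = p 2 * q 0 - p 0 * q 2 := ⟨_, rfl⟩
  obtain ⟨z, hz⟩ : ∃ z, z = p 0 * q 1 - p 1 * q 0 := ⟨_, rfl⟩
  have hxyz : ¬ (x = 0 ∧ y = 0 ∧ z = 0) := by
    rintro ⟨h0, h1, h2⟩
    refine (Matrix.isUnits_det_units A).ne_zero ?_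
    rw [det_fin_three, ← hp, ← hq, ← hr]
    linear_combination r 0 * (h0 - hx) + r 1 * (h1 - hy) + r 2 * (h2 - hz)
  have key (u : Fin 3 → ℂ) : a * (3 * (x ^ 2 * u 0 + y ^ 2 * u 1 + z ^ 2 * u 2)) +
      b * (u 0 * y * z + x * u 1 * z + x * y * u 2) = 0 := by
    have hP : p 0 * x + p 1 * y + p 2 * z = 0 := by rw [hx, hy, hz]; ring
    have hQ : q 0 * x + q 1 * y + q 2 * z = 0 := by rw [hx, hy, hz]; ring
    have H (t : ℂ) : (t * (p 0 * u 0 + p 1 * u 1 + p 2 * u 2)) *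
        (t * (q 0 * u 0 + q 1 * u 1 + q 2 * u 2)) *
        ((r 0 * x + r 1 * y + r 2 * z) + t * (r 0 * u 0 + r 1 * u 1 + r 2 * u 2)) =
        a * ((x + t * u 0) ^ 3 + (y + t * u 1) ^ 3 + (z + t * u 2) ^ 3) +
        b * ((x + t * u 0) * (y + t * u 1) * (z + t * u 2)) := by
      have := h ![x + t * u 0, y + t * u 1, z + t * u 2]
      rw [hA] at this
      simp only [cubeSum, coordProd, cons_val] at this
      rw [← this, show p 0 * (x + t * u 0) + p 1 * (y + t * u 1) + p 2 * (z + t * u 2) =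
        t * (p 0 * u 0 + p 1 * u 1 + p 2 * u 2) by linear_combination hP,
        show q 0 * (x + t * u 0) + q 1 * (y + t * u 1) + q 2 * (z + t * u 2) =
        t * (q 0 * u 0 + q 1 * u 1 + q 2 * u 2) by linear_combination hQ]
      ring
    -- Both sides of `H` are cubic polynomials in t, and the left one is divisible by t². For a
    -- cubic f, the difference (8(f(1) - f(-1)) - (f(2) - f(-2))) / 12 is exactly the coefficient of
    -- t.
    linear_combination (-8 * (H 1 - H (-1)) + (H 2 - H (-2))) / 12
  have e0 : a * (3 * x ^ 2) + b * (y * z) = 0 := by simpa using key ![1, 0, 0]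
  have e1 : a * (3 * y ^ 2) + b * (x * z) = 0 := by simpa using key ![0, 1, 0]
  have e2 : a * (3 * z ^ 2) + b * (x * y) = 0 := by simpa using key ![0, 0, 1]
  have hx0 : x ≠ 0 := by
    rintro h0
    rw [h0] at e1 e2
    exact hxyz ⟨h0, by simpa [ha] using e1, by simpa [ha] using e2⟩
  have hy0 : y ≠ 0 := by
    rintro h0
    rw [h0] at e0 e2
    exact hxyz ⟨by simpa [ha] using e0, h0, by simpa [ha] using e2⟩
  have hz0 : z ≠ 0 := by
    rintro h0
    rw [h0] at e0 e1
    exact hxyz ⟨by simpa [ha] using e0, by simpa [ha] using e1, h0⟩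
  have hne : (x * y * z) ^ 2 ≠ 0 := pow_ne_zero 2 (mul_ne_zero (mul_ne_zero hx0 hy0) hz0)
  -- The product of the three gradient equations 3ax² = -byz, 3ay² = -bxz, 3az² = -bxy.
  have : (b ^ 3 + 27 * a ^ 3) * (x * y * z) ^ 2 = 0 := by
    have f0 : b * (y * z) = -(a * (3 * x ^ 2)) := by linear_combination e0
    have f1 : b * (x * z) = -(a * (3 * y ^ 2)) := by linear_combination e1
    have f2 : b * (x * y) = -(a * (3 * z ^ 2)) := by linear_combination e2
    have : b ^ 3 * (x * y * z) ^ 2 = (b * (y * z)) * (b * (x * z)) * (b * (x * y)) := by ring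
    rw [add_mul, this, f0, f1, f2]
    ring
  linear_combination (mul_eq_zero.1 this).resolve_right hne

/-- If A pulls xyz back to a triangle other than xyz, a generated B pulls xyz back to the same
triangle up to scale, and A B⁻¹ preserves xyz. -/
theorem linearStabilizer_eq_generatedGL : linearStabilizer = generatedGL := by
  refine le_antisymm (fun A hA => ?_) generatedGL_le_linearStabilizer
  obtain ⟨-, a, b, h⟩ := mem_linearStabilizer.1 hA
  rcases eq_or_ne a 0 with rfl | ha
  · exact mem_generatedGL_of_coordProd hA (fun v => by rw [h, zero_mul, zero_add])
  · obtain ⟨j, -, hj⟩ := ε_prim.eq_pow_of_pow_eq_one (ξ := -b / (3 * a)) (by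
      rw [div_pow, div_eq_one_iff_eq (by simpa using ha)]
      linear_combination -triangle_of_pencil h ha)
    have hb : b = -3 * a * ε ^ j := by
      rw [hj]
      field_simp
    -- `M₄` multiplies xyz by ε² and fixes the sum of cubes, so the power 2j contributes ε^(4j) =
    -- ε^j.
    let B := M₃ * M₄ ^ (2 * j)
    have hB : B ∈ generatedGL := mul_mem M₃_mem_generatedGL (pow_mem M₄_mem_generatedGL _)
    have hm₄ (v : Fin 3 → ℂ) (n : ℕ) : cubeSum (m₄ ^ n *ᵥ v) = cubeSum v ∧
        coordProd (m₄ ^ n *ᵥ v) = ε ^ (2 * n) * coordProd v := by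
      induction n with
      | zero => simp
      | succ n ih =>
        rw [pow_succ', ← mulVec_mulVec, m₄_mulVec, ← ih.1, mul_add, pow_add, mul_right_comm,
          ← ih.2]
        simp only [cubeSum, coordProd, cons_val]
        constructor
        · linear_combination ((m₄ ^ n *ᵥ v) 1 ^ 3 + (m₄ ^ n *ᵥ v) 2 ^ 3) * ε_pow_three
        · ring
    have hBv (v : Fin 3 → ℂ) : a * coordProd (B.val *ᵥ v) = coordProd (A.val *ᵥ v) := by
      change a * coordProd ((m₃ * m₄ ^ (2 * j)) *ᵥ v) = _
      rw [← mulVec_mulVec, coordProd_m₃, (hm₄ v _).1, (hm₄ v _).2, h, hb,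
        show 2 * (2 * j) = 3 * j + j by ring, pow_add, pow_mul, ε_pow_three, one_pow]
      ring
    have hA' : A * B⁻¹ ∈ generatedGL := by
      refine mem_generatedGL_of_coordProd
        (mul_mem hA (inv_mem (generatedGL_le_linearStabilizer hB))) (b := a) (fun v => ?_)
      rw [Units.val_mul, ← mulVec_mulVec, ← hBv, mulVec_mulVec, ← Units.val_mul, mul_inv_cancel,
        Units.val_one, one_mulVec]
    exact (Subgroup.mul_mem_cancel_right _ (inv_mem hB)).1 hA'

theorem hessianGroup_eq : hessianGroup = Γ ⊔ SL23 := by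
  rw [hessianGroup, linearStabilizer_eq_generatedGL, generatedGL,
    Subgroup.map_comap_eq_self_of_surjective ProjGenLinGroup.mk_surjective]

/-! ### The invariance of the sextic -/

/-- The linear transformations under which `Φ₆` is multiplied by a constant `c` such that
`c³ = det⁶`. -/
def sexticSemiinvariance : Subgroup (GL (Fin 3) ℂ) where
  carrier := {A | ∃ c : ℂ, (∀ v, HessianK3.Φ₆ (A.val *ᵥ v) = c * HessianK3.Φ₆ v) ∧
    c ^ 3 = A.val.det ^ 6}
  mul_mem' := by
    rintro A B ⟨c, hc, hc3⟩ ⟨d, hd, hd3⟩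
    refine ⟨c * d, fun v => ?_, ?_⟩
    · rw [Units.val_mul, ← mulVec_mulVec, hc, hd, mul_assoc]
    · rw [Units.val_mul, det_mul, mul_pow, mul_pow, hc3, hd3]
  one_mem' := ⟨1, fun v => by simp, by simp⟩
  inv_mem' := by
    rintro A ⟨c, hc, hc3⟩
    have hd : A⁻¹.val.det * A.val.det = 1 := by rw [← det_mul, ← Units.val_mul]; simp
    have h0 : c ≠ 0 := by
      rintro rfl
      have : A.val.det ≠ 0 := (Matrix.isUnits_det_units A).ne_zero
      exact pow_ne_zero 6 this (by rw [← hc3]; simp)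
    refine ⟨c⁻¹, fun v => ?_, ?_⟩
    · have := hc (A⁻¹.val *ᵥ v)
      rw [mulVec_mulVec, ← Units.val_mul, mul_inv_cancel, Units.val_one, one_mulVec] at this
      rw [this, inv_mul_cancel_left₀ h0]
    · rw [inv_pow, hc3, ← inv_pow, eq_inv_of_mul_eq_one_left hd]

/-- The linear transformations `A` with `Φ₆(Av) = det(A)² Φ₆(v)`. -/
def sexticInvariance : Subgroup (GL (Fin 3) ℂ) where
  carrier := {A | ∀ v, HessianK3.Φ₆ (A.val *ᵥ v) = A.val.det ^ 2 * HessianK3.Φ₆ v}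
  mul_mem' := by
    intro A B hA hB v
    rw [Units.val_mul, ← mulVec_mulVec, hA, hB, det_mul, mul_pow, mul_assoc]
  one_mem' := by
    intro v
    simp
  inv_mem' := by
    intro A hA v
    have hd : A⁻¹.val.det * A.val.det = 1 := by rw [← det_mul, ← Units.val_mul]; simp
    have := hA (A⁻¹.val *ᵥ v)
    rw [mulVec_mulVec, ← Units.val_mul, mul_inv_cancel, Units.val_one, one_mulVec] at this
    rw [this, ← mul_assoc, ← mul_pow, hd, one_pow, one_mul]

theorem sexticInvariance_le : sexticInvariance ≤ sexticSemiinvariance :=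
  fun A hA => ⟨A.val.det ^ 2, hA, by ring⟩

theorem scalar_mem_sexticInvariance (u : ℂˣ) :
    GeneralLinearGroup.scalar (Fin 3) u ∈ sexticInvariance := by
  intro v
  rw [GeneralLinearGroup.coe_scalar, scalar_apply, ← smul_one_eq_diagonal, smul_mulVec,
    one_mulVec, det_smul, det_one]
  simp only [HessianK3.Φ₆, Pi.smul_apply, smul_eq_mul, Fintype.card_fin]
  ring

theorem M₁_mem_sexticInvariance : M₁ ∈ sexticInvariance := by
  intro v
  change HessianK3.Φ₆ (m₁ *ᵥ v) = m₁.det ^ 2 * _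
  have : m₁.det = 1 := by simp [m₁, det_fin_three]
  rw [this]
  simp only [m₁_mulVec, HessianK3.Φ₆, cons_val]
  ring

theorem M₂_mem_sexticInvariance : M₂ ∈ sexticInvariance := by
  intro v
  change HessianK3.Φ₆ (m₂ *ᵥ v) = m₂.det ^ 2 * _
  have h3 := ε_pow_three
  have : m₂.det = 1 := by simp [m₂, det_fin_three]; grind
  rw [this]
  simp only [m₂_mulVec, HessianK3.Φ₆, cons_val]
  have e3 (x : ℂ) : (ε * x) ^ 3 = x ^ 3 := by rw [mul_pow, h3, one_mul]
  have e3' (x : ℂ) : (ε ^ 2 * x) ^ 3 = x ^ 3 := by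
    rw [mul_pow, ← pow_mul, mul_comm 2, pow_mul, h3, one_pow, one_mul]
  rw [pow_mul (ε * v 1) 3 2, pow_mul (ε ^ 2 * v 2) 3 2, e3, e3']
  ring

theorem M₃_mem_sexticInvariance : M₃ ∈ sexticInvariance := by
  intro v
  change HessianK3.Φ₆ (m₃ *ᵥ v) = m₃.det ^ 2 * _
  have h2 := ε_sq
  have : m₃.det ^ 2 = -27 := by
    simp [m₃, det_fin_three]
    grind
  rw [this, Φ₆_m₃]

theorem Φ₆_m₄ (v : Fin 3 → ℂ) : HessianK3.Φ₆ (m₄ *ᵥ v) = HessianK3.Φ₆ v := by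
  have h3 := ε_pow_three
  simp only [m₄_mulVec, HessianK3.Φ₆, cons_val]
  have e3 (x : ℂ) : (ε * x) ^ 3 = x ^ 3 := by rw [mul_pow, h3, one_mul]
  rw [pow_mul (ε * v 1) 3 2, pow_mul (ε * v 2) 3 2, e3, e3]
  ring

/-- Here Φ₆ is preserved while det² = ε⁴ = ε, so `M₄` satisfies only the weaker condition; its cube
is what matters. -/
theorem M₄_mem_sexticSemiinvariance : M₄ ∈ sexticSemiinvariance := by
  refine ⟨1, fun v => (Φ₆_m₄ v).trans (one_mul _).symm, ?_⟩
  change _ = m₄.det ^ 6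
  have : m₄.det = ε ^ 2 := by simp [m₄, det_fin_three]; ring
  rw [this, ← pow_mul, show 2 * 6 = 3 * 4 by norm_num, pow_mul, ε_pow_three]
  simp

/-- A subgroup containing all scalars contains the kernel of the projection, so one lift of each
element suffices. -/
theorem comap_mk_le {K : Subgroup PGL(Fin 3, ℂ)} {S : Subgroup (GL (Fin 3) ℂ)}
    (hS : ∀ u, GeneralLinearGroup.scalar (Fin 3) u ∈ S)
    (h : K ≤ S.map ProjGenLinGroup.mk) : K.comap ProjGenLinGroup.mk ≤ S := by
  intro A hA
  obtain ⟨B, hB, hBA⟩ := h hA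
  obtain ⟨u, rfl⟩ := ProjGenLinGroup.mk_eq_mk_iff.1 hBA
  exact mul_mem hB (hS u)

theorem linearStabilizer_le_sexticSemiinvariance : linearStabilizer ≤ sexticSemiinvariance := by
  rw [linearStabilizer_eq_generatedGL]
  refine comap_mk_le (fun u => sexticInvariance_le (scalar_mem_sexticInvariance u)) ?_
  exact Γ_sup_SL23_le ⟨M₁, sexticInvariance_le M₁_mem_sexticInvariance, rfl⟩
    ⟨M₂, sexticInvariance_le M₂_mem_sexticInvariance, rfl⟩
    ⟨M₃, sexticInvariance_le M₃_mem_sexticInvariance, rfl⟩ ⟨M₄, M₄_mem_sexticSemiinvariance, rfl⟩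

/-- `M₄` leaves Φ₆ unchanged, so conjugation by it alters neither the factor of Φ₆ nor the
determinant. This is the lift of `g₅`. -/
theorem conj_M₄_mem_sexticInvariance : M₄ * M₃ * M₄⁻¹ ∈ sexticInvariance := by
  intro v
  have hd : (M₄ * M₃ * M₄⁻¹).val.det = m₃.det := by
    rw [Units.val_mul, Units.val_mul, det_mul, det_mul, mul_right_comm, ← det_mul,
      ← Units.val_mul, mul_inv_cancel]
    simp [M₃]
  have h4 (w : Fin 3 → ℂ) : HessianK3.Φ₆ (M₄.val *ᵥ w) = HessianK3.Φ₆ w := Φ₆_m₄ w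
  have h3 := M₃_mem_sexticInvariance (M₄⁻¹.val *ᵥ v)
  rw [hd, Units.val_mul, Units.val_mul, mul_assoc, ← mulVec_mulVec, ← mulVec_mulVec, h4, h3,
    ← h4 (M₄⁻¹.val *ᵥ v), mulVec_mulVec, ← Units.val_mul, mul_inv_cancel, Units.val_one,
    one_mulVec]
  rfl

theorem mem_sexticInvariance {Q : Sylow 2 SL23} {A : GL (Fin 3) ℂ}
    (hA : ProjGenLinGroup.mk A ∈ H72 Q) : A ∈ sexticInvariance := by
  refine comap_mk_le (K := H72 Q) scalar_mem_sexticInvariance ?_ hA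
  rw [H72, Q8_eq_quaternion, Γ, quaternion]
  refine sup_le ((Subgroup.closure_le _).2 ?_) ((Subgroup.closure_le _).2 ?_)
  · rintro _ (rfl | rfl)
    · exact ⟨M₁, M₁_mem_sexticInvariance, rfl⟩
    · exact ⟨M₂, M₂_mem_sexticInvariance, rfl⟩
  · rintro _ (rfl | rfl)
    · exact ⟨M₃, M₃_mem_sexticInvariance, rfl⟩
    · exact ⟨_, conj_M₄_mem_sexticInvariance, rfl⟩

end Hessian

/-! ### The surface is compact and connected -/

namespace HessianK3

/-- The points of the affine cone over `X` with `‖v‖ = 1`. -/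
def Link : Type := {a : V // ‖a.1‖ = 1 ∧ F a = 0}

namespace Link

instance : TopologicalSpace Link :=
  inferInstanceAs (TopologicalSpace {a : V // ‖a.1‖ = 1 ∧ F a = 0})

instance : T2Space Link := inferInstanceAs (T2Space {a : V // ‖a.1‖ = 1 ∧ F a = 0})

theorem continuous_Φ₆ : Continuous Φ₆ := by
  unfold Φ₆
  fun_prop

instance : CompactSpace Link := by
  refine isCompact_iff_compactSpace.1 (Metric.isCompact_of_isClosed_isBounded ?_ ?_)
  · exact (isClosed_eq (by fun_prop) continuous_const).inter
      (isClosed_eq contDiff_F.continuous continuous_const)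
  · obtain ⟨C, hC⟩ := (isCompact_sphere (0 : Fin 3 → ℂ) 1).exists_bound_of_continuousOn
      continuous_Φ₆.continuousOn
    refine isBounded_iff_forall_norm_le.2 ⟨max 1 (C + 1), ?_⟩
    rintro ⟨v, w⟩ ⟨h1, h2⟩
    simp only at h1
    have h3 : w ^ 2 = -Φ₆ v := eq_neg_of_add_eq_zero_left h2
    have h4 : ‖w‖ ^ 2 ≤ C := by
      rw [← norm_pow, h3, norm_neg]
      exact hC v (by simp [h1])
    rw [Prod.norm_def, h1]
    refine max_le_max le_rfl ?_
    nlinarith [sq_nonneg (‖w‖ - 1), norm_nonneg w]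

theorem ne_zero {a : V} (h : ‖a.1‖ = 1) : a ≠ 0 := by
  rintro rfl
  simp at h

/-- The point of `X` defined by a point of the link. -/
def toX (k : Link) : X := X.mk k.1 (ne_zero k.2.1) k.2.2

theorem continuous_toX : Continuous toX := by
  refine Continuous.subtype_mk ?_ _
  exact isQuotientMap_mk.continuous.comp
    (f := fun k : Link => (⟨k.1, ne_zero k.2.1⟩ : {a : V // a ≠ 0}))
    (Continuous.subtype_mk continuous_subtype_val _)

theorem surjective_toX : Function.Surjective toX := by
  intro p
  induction p using X.ind with
  | h a ha hF =>
    have hn : ((‖a.1‖ : ℝ) : ℂ) ≠ 0 := by simpa using fst_ne_zero ha hF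
    refine ⟨⟨((‖a.1‖ : ℂ)⁻¹ • a.1, (‖a.1‖ : ℂ)⁻¹ ^ 3 * a.2), ?_, ?_⟩, ?_⟩
    · rw [norm_smul, norm_inv, Complex.norm_real, norm_norm, inv_mul_cancel₀ (by simpa using hn)]
    · rw [F_weighted, hF, mul_zero]
    · exact (X.mk_eq_mk.2 ⟨_, inv_ne_zero hn, rfl⟩).symm

/-- The covering involution. -/
def invol (k : Link) : Link := ⟨(k.1.1, -k.1.2), k.2.1, by
  have := k.2.2
  simpa [F] using this⟩

theorem continuous_invol : Continuous invol := by
  have h : Continuous fun k : Link => k.1 := continuous_subtype_val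
  exact Continuous.subtype_mk ((continuous_fst.comp h).prodMk (continuous_snd.comp h).neg) _

theorem invol_invol (k : Link) : invol (invol k) = k := by
  refine Subtype.ext (Prod.ext rfl ?_)
  exact neg_neg _

/-- The projection to the unit sphere of `ℂ³`. -/
def toSphere (k : Link) : Metric.sphere (0 : Fin 3 → ℂ) 1 := ⟨k.1.1, by simpa using k.2.1⟩

theorem continuous_toSphere : Continuous toSphere :=
  Continuous.subtype_mk (continuous_fst.comp continuous_subtype_val) _

theorem surjective_toSphere : Function.Surjective toSphere := by
  rintro ⟨v, hv⟩
  obtain ⟨w, hw⟩ := IsAlgClosed.exists_pow_nat_eq (-Φ₆ v) (n := 2) (by norm_num)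
  exact ⟨⟨(v, w), by simpa using hv, by simp [F, hw]⟩, rfl⟩

theorem eq_or_eq_of_toSphere {k k' : Link} (h : toSphere k = toSphere k') :
    k' = k ∨ k' = invol k := by
  have h1 : k.1.1 = k'.1.1 := congrArg Subtype.val h
  have h2 : k'.1.2 ^ 2 = k.1.2 ^ 2 := by
    have e1 : k.1.2 ^ 2 + Φ₆ k.1.1 = 0 := k.2.2
    have e2 : k'.1.2 ^ 2 + Φ₆ k'.1.1 = 0 := k'.2.2
    rw [← h1] at e2
    linear_combination e2 - e1
  rcases sq_eq_sq_iff_eq_or_eq_neg.1 h2 with h | h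
  · exact .inl (Subtype.ext (Prod.ext h1.symm h))
  · exact .inr (Subtype.ext (Prod.ext h1.symm h))

instance : PreconnectedSpace (Metric.sphere (0 : Fin 3 → ℂ) 1) := by
  refine isPreconnected_iff_preconnectedSpace.1 (isPreconnected_sphere ?_ _ _)
  rw [← Module.finrank_eq_rank, Module.finrank_pi_fintype]
  simp

/-- An invariant set is a union of fibres of the double cover. The projection is closed by
compactness, so the image of S and its complement are both closed in the connected sphere. -/
theorem eq_empty_or_univ_of_invol {S : Set Link} (hS : IsClopen S) (hi : invol ⁻¹' S = S) :
    S = ∅ ∨ S = Set.univ := by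
  have hcl := continuous_toSphere.isClosedMap
  have hc : (toSphere '' S)ᶜ = toSphere '' Sᶜ := by
    ext v
    obtain ⟨k, rfl⟩ := surjective_toSphere v
    have hk : toSphere k ∈ toSphere '' S ↔ k ∈ S := by
      refine ⟨?_, fun h => ⟨k, h, rfl⟩⟩
      rintro ⟨k', hk', h⟩
      rcases eq_or_eq_of_toSphere h with rfl | rfl
      · exact hk'
      · rw [← hi] at hk'
        exact hk'
    have hk' : toSphere k ∈ toSphere '' Sᶜ ↔ k ∉ S := by
      refine ⟨?_, fun h => ⟨k, h, rfl⟩⟩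
      rintro ⟨k', hk', h⟩ hkS
      rcases eq_or_eq_of_toSphere h with rfl | rfl
      · exact hk' hkS
      · rw [← hi] at hkS
        exact hk' (by simpa [invol_invol] using hkS)
    rw [Set.mem_compl_iff, hk, hk']
  have hT : IsClopen (toSphere '' S) :=
    ⟨hcl _ hS.isClosed, by rw [← isClosed_compl_iff, hc]; exact hcl _ hS.compl.isClosed⟩
  rcases isClopen_iff.1 hT with h | h
  · exact .inl (Set.image_eq_empty.1 h)
  · right
    rw [← compl_compl (toSphere '' S), hc, Set.compl_univ_iff, Set.image_eq_empty] at h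
    exact Set.compl_empty_iff.1 h

/-- A branch point of the double cover. -/
theorem exists_invol_eq : ∃ k : Link, invol k = k := by
  -- On z = 0, y = 1 the sextic is x⁶ - 10x³ + 1, whose roots satisfy x³ = 5 ± √24.
  obtain ⟨r, hr⟩ := IsAlgClosed.exists_pow_nat_eq (24 : ℂ) (n := 2) (by norm_num)
  obtain ⟨x, hx⟩ := IsAlgClosed.exists_pow_nat_eq (5 + r) (n := 3) (by norm_num)
  have h0 : Φ₆ ![x, 1, 0] = 0 := by
    simp only [Φ₆, Matrix.cons_val]
    linear_combination (x ^ 3 + r - 5) * hx + hr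
  have ha : ((![x, 1, 0], 0) : V) ≠ 0 := fun h =>
    one_ne_zero (congrFun (congrArg Prod.fst h) 1)
  have hF : F (![x, 1, 0], 0) = 0 := by simp [F, h0]
  have hn : ((‖(![x, 1, 0] : Fin 3 → ℂ)‖ : ℝ) : ℂ) ≠ 0 := by
    simp
  obtain ⟨k, hk⟩ := surjective_toX (X.mk _ ha hF)
  obtain ⟨c, hc, hkc⟩ := X.mk_eq_mk.1 hk.symm
  refine ⟨k, Subtype.ext (Prod.ext rfl ?_)⟩
  change -k.1.2 = k.1.2
  rw [hkc]
  simp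

/-- A clopen set containing a branch point meets its mirror image in a nonempty invariant clopen
set, which must be everything. -/
instance : PreconnectedSpace Link := by
  refine preconnectedSpace_iff_clopen.2 fun S hS => ?_
  obtain ⟨b, hb⟩ := exists_invol_eq
  have key : ∀ S : Set Link, IsClopen S → b ∈ S → S = Set.univ := by
    intro S hS hbS
    have hinv : invol ⁻¹' (S ∩ invol ⁻¹' S) = S ∩ invol ⁻¹' S := by
      ext k
      simp [invol_invol, and_comm]
    rcases eq_empty_or_univ_of_invol (hS.inter (hS.preimage continuous_invol)) hinv with h | h
    · exact absurd (show b ∈ S ∩ invol ⁻¹' S from ⟨hbS, by simpa [hb] using hbS⟩) (by simp [h])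
    · exact Set.univ_subset_iff.1 (h ▸ Set.inter_subset_left)
  by_cases hbS : b ∈ S
  · exact .inr (key S hS hbS)
  · exact .inl (Set.compl_univ_iff.1 (key Sᶜ hS.compl hbS))

end Link

instance : CompactSpace X := Link.surjective_toX.compactSpace Link.continuous_toX

instance : PreconnectedSpace X where
  isPreconnected_univ := by
    rw [← Link.surjective_toX.range_eq, ← Set.image_univ]
    exact isPreconnected_univ.image _ Link.continuous_toX.continuousOn

theorem surjective_q : Function.Surjective q := by
  intro x
  induction x using Projectivization.ind with
  | h v hv =>
    obtain ⟨w, hw⟩ := IsAlgClosed.exists_pow_nat_eq (-Φ₆ v) (n := 2) (by norm_num)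
    exact ⟨X.mk (v, w) (fun h => hv (congrArg Prod.fst h)) (by simp [F, hw]), q_mk _ _ _⟩

end HessianK3

/-! ### The residue form in local coordinates -/

namespace HessianK3

/-- The weighted Euler vector field. -/
def euler (a : V) : V := (a.1, 3 * a.2)

theorem dF_euler (a : V) : dF a (euler a) = 6 * F a := by
  simp only [dF, euler, F, Φ₆, LinearMap.coe_mk, AddHom.coe_mk]
  ring

/-- The action of `c` with weights `(1, 1, 1, 3)`. -/
def weightedScale (c : ℂ) : V →L[ℂ] V :=
  (c • ContinuousLinearMap.id ℂ (Fin 3 → ℂ)).prodMap (c ^ 3 • ContinuousLinearMap.id ℂ ℂ)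

theorem weightedScale_apply (c : ℂ) (a : V) : weightedScale c a = (c • a.1, c ^ 3 * a.2) := rfl

theorem normalize_eq (i : Fin 3) (a : V) : normalize i a = weightedScale (a.1 i)⁻¹ a := rfl

theorem weightedScale_euler (c : ℂ) (a : V) :
    weightedScale c (euler a) = euler (weightedScale c a) := by
  simp only [weightedScale_apply, euler]
  exact Prod.ext rfl (by ring)

theorem dF_weightedScale (c : ℂ) (a ξ : V) :
    dF (weightedScale c a) (weightedScale c ξ) = c ^ 6 * dF a ξ := by
  simp only [dF, weightedScale_apply, LinearMap.coe_mk, AddHom.coe_mk, Pi.smul_apply, smul_eq_mul]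
  ring

/-- The exponent 1 + 1 + 1 + 3 agrees with the degree of F in `dF_weightedScale`. This coincidence
makes the residue form independent of the scaling of coordinates. -/
theorem det_weightedScale (c : ℂ) : LinearMap.det (weightedScale c : V →ₗ[ℂ] V) = c ^ 6 := by
  have : (weightedScale c : V →ₗ[ℂ] V) =
      (c • (LinearMap.id : (Fin 3 → ℂ) →ₗ[ℂ] _)).prodMap (c ^ 3 • (LinearMap.id : ℂ →ₗ[ℂ] ℂ)) := rfl
  rw [this, LinearMap.det_prodMap, LinearMap.det_smul, LinearMap.det_smul]
  simp
  ring

/-- Differentiating the scaling factor only adds a multiple of the Euler field, which drops out of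
any determinant that already contains that field. -/
theorem hasFDerivAt_normalize (i : Fin 3) {a : V} (hi : a.1 i ≠ 0) :
    ∃ N : V →L[ℂ] V, HasFDerivAt (normalize i) N a ∧
      ∀ ζ, N ζ = weightedScale (a.1 i)⁻¹ ζ + (-(ζ.1 i / a.1 i)) • euler (normalize i a) := by
  have h1 : HasFDerivAt (fun b : V => b.1)
      (ContinuousLinearMap.fst ℂ (Fin 3 → ℂ) ℂ) a := hasFDerivAt_fst
  have h2 : HasFDerivAt (fun b : V => b.2)
      (ContinuousLinearMap.snd ℂ (Fin 3 → ℂ) ℂ) a := hasFDerivAt_snd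
  have hx : HasFDerivAt (fun b : V => b.1 i)
      ((ContinuousLinearMap.proj i).comp (ContinuousLinearMap.fst ℂ (Fin 3 → ℂ) ℂ)) a :=
    ((ContinuousLinearMap.proj i).comp (ContinuousLinearMap.fst ℂ (Fin 3 → ℂ) ℂ)).hasFDerivAt
  have hinv : HasFDerivAt (fun b : V => (b.1 i)⁻¹) _ a := (hasDerivAt_inv hi).comp_hasFDerivAt a hx
  refine ⟨_, (hinv.smul h1).prodMk ((hinv.pow 3).mul h2), fun ζ => ?_⟩
  refine Prod.ext ?_ ?_
  · funext j
    simp [weightedScale_apply, euler, normalize]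
    field_simp
  · simp [weightedScale_apply, euler, normalize]
    field_simp

/-- The differential of `slice`. -/
def sliceDeriv (i : Fin 3) (ℓ : V →L[ℂ] ℂ × ℂ) (a : V) : V →ₗ[ℂ] (ℂ × ℂ) × (ℂ × ℂ) :=
  (((LinearMap.proj i).comp (LinearMap.fst ℂ (Fin 3 → ℂ) ℂ)).prod (dF a)).prod ℓ.toLinearMap

theorem sliceDeriv_apply (i : Fin 3) (ℓ : V →L[ℂ] ℂ × ℂ) (a ζ : V) :
    sliceDeriv i ℓ a ζ = ((ζ.1 i, dF a ζ), ℓ ζ) := rfl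

theorem hasFDerivAt_slice (i : Fin 3) (ℓ : V →L[ℂ] ℂ × ℂ) (a : V) :
    HasFDerivAt (slice i ℓ) (LinearMap.toContinuousLinearMap (sliceDeriv i ℓ a)) a := by
  have h1 : HasFDerivAt (fun b : V => b.1 i)
      ((ContinuousLinearMap.proj i).comp (ContinuousLinearMap.fst ℂ (Fin 3 → ℂ) ℂ)) a :=
    ((ContinuousLinearMap.proj i).comp (ContinuousLinearMap.fst ℂ (Fin 3 → ℂ) ℂ)).hasFDerivAt
  have h2 : HasFDerivAt F (fderiv ℂ F a) a :=
    (contDiff_F.differentiable (by simp)).differentiableAt.hasFDerivAt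
  refine ((h1.prodMk h2).prodMk ℓ.hasFDerivAt).congr_fderiv ?_
  exact ContinuousLinearMap.ext fun η => Prod.ext (Prod.ext rfl (fderiv_F a η)) rfl

/-- The coordinates of `(ℂ × ℂ) × (ℂ × ℂ)`. -/
def coords : (ℂ × ℂ) × (ℂ × ℂ) →ₗ[ℂ] Fin 4 → ℂ where
  toFun t := ![t.1.1, t.1.2, t.2.1, t.2.2]
  map_add' s t := by
    funext i
    fin_cases i <;> rfl
  map_smul' c t := by
    funext i
    fin_cases i <;> rfl

/-- The standard volume form on `(ℂ × ℂ) × (ℂ × ℂ)`. -/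
def vol : ((ℂ × ℂ) × (ℂ × ℂ)) [⋀^Fin 4]→ₗ[ℂ] ℂ :=
  (Matrix.detRowAlternating (n := Fin 4) (R := ℂ)).compLinearMap coords

theorem vol_apply (w : Fin 4 → (ℂ × ℂ) × (ℂ × ℂ)) :
    vol w = Matrix.det (Matrix.of fun j => coords (w j)) := rfl

/-- The standard area form on `ℂ × ℂ`. -/
def wedge (u v : ℂ × ℂ) : ℂ := u.1 * v.2 - u.2 * v.1

/-- Subtracting multiples of the first row makes the matrix block triangular. -/
theorem vol_eq (e f u v : ℂ × ℂ) (x y k k' : ℂ) :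
    vol ![((1, 0), e), ((x, y), f), ((0, 0), u) + k • ((1, 0), e), ((0, 0), v) + k' • ((1, 0), e)] =
      y * wedge u v := by
  simp [vol_apply, Matrix.det_succ_row_zero, Fin.sum_univ_succ, coords, wedge, Fin.succAbove]
  ring

/-- A basis of `ℂ³ × ℂ`. -/
def basisV : Module.Basis (Fin 4) ℂ V := Module.finBasisOfFinrankEq ℂ V (by simp)

/-- The Jacobian determinant of `slice`. -/
def sliceDet (i : Fin 3) (ℓ : V →L[ℂ] ℂ × ℂ) (a : V) : ℂ :=
  vol fun j => sliceDeriv i ℓ a (basisV j)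

theorem vol_sliceDeriv (i : Fin 3) (ℓ : V →L[ℂ] ℂ × ℂ) (a : V) (w : Fin 4 → V) :
    (vol fun j => sliceDeriv i ℓ a (w j)) = sliceDet i ℓ a * basisV.det w :=
  congrArg (fun f : V [⋀^Fin 4]→ₗ[ℂ] ℂ => f w)
    ((vol.compLinearMap (sliceDeriv i ℓ a)).eq_smul_basis_det basisV)

theorem differentiable_sliceDet (i : Fin 3) (ℓ : V →L[ℂ] ℂ × ℂ) :
    Differentiable ℂ (sliceDet i ℓ) := by
  have h (j k : Fin 4) : Differentiable ℂ fun a => coords (sliceDeriv i ℓ a (basisV j)) k := by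
    fin_cases k
    · exact differentiable_const ((basisV j).1 i)
    · change Differentiable ℂ fun a => dF a (basisV j)
      simp only [dF, LinearMap.coe_mk, AddHom.coe_mk]
      fun_prop
    · exact differentiable_const (ℓ (basisV j)).1
    · exact differentiable_const (ℓ (basisV j)).2
  unfold sliceDet
  simp only [vol_apply, Matrix.det_apply, Matrix.of_apply]
  refine Differentiable.fun_sum fun σ _ => ?_
  have hp : Differentiable ℂ fun a => ∏ j, coords (sliceDeriv i ℓ a (basisV (σ j))) j :=
    fun a => (HasFDerivAt.finsetProd (u := Finset.univ)
      (g := fun j a => coords (sliceDeriv i ℓ a (basisV (σ j))) j)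
      fun j _ => (h (σ j) j a).hasFDerivAt).differentiableAt
  rcases Int.units_eq_one_or (Equiv.Perm.sign σ) with hσ | hσ
  · simpa only [hσ, one_smul] using hp
  · simp only [hσ, Units.neg_smul, one_smul]
    exact hp.neg

namespace ChartData

variable (D : ChartData)

/-- The derivative of the parametrization. -/
theorem hasFDerivAt_lift {s : ℂ × ℂ} (hs : s ∈ D.dom) :
    HasFDerivAt D.lift (fderiv ℂ D.lift s) s :=
  ((D.contDiffOn_lift.contDiffAt (D.isOpen_dom.mem_nhds hs)).differentiableAt (by simp)).hasFDerivAt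

theorem sliceDeriv_lift {s : ℂ × ℂ} (hs : s ∈ D.dom) (u : ℂ × ℂ) :
    sliceDeriv D.i D.ℓ (D.lift s) (fderiv ℂ D.lift s u) = ((0, 0), u) := by
  have h1 := (hasFDerivAt_slice D.i D.ℓ (D.lift s)).comp s (D.hasFDerivAt_lift hs)
  have h2 : HasFDerivAt (fun t : ℂ × ℂ => (((1 : ℂ), (0 : ℂ)), t))
      ((0 : ℂ × ℂ →L[ℂ] ℂ × ℂ).prod (ContinuousLinearMap.id ℂ (ℂ × ℂ))) s :=
    (hasFDerivAt_const _ _).prodMk (hasFDerivAt_id s)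
  have h3 := h2.congr_of_eventuallyEq (f₁ := slice D.i D.ℓ ∘ D.lift)
    (Filter.eventually_of_mem (D.isOpen_dom.mem_nhds hs) fun t ht => D.slice_lift ht)
  exact congrArg (fun f : ℂ × ℂ →L[ℂ] (ℂ × ℂ) × (ℂ × ℂ) => f u) (h1.unique h3)

theorem sliceDeriv_surjective {s : ℂ × ℂ} (hs : s ∈ D.dom) :
    Function.Surjective (sliceDeriv D.i D.ℓ (D.lift s)) := by
  have ht : ((1, 0), s) ∈ D.Ψ.target := hs
  have h1 : HasFDerivAt D.Ψ.symm (fderiv ℂ D.Ψ.symm ((1, 0), s)) ((1, 0), s) :=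
    ((D.contDiff_symm.contDiffAt (D.Ψ.open_target.mem_nhds ht)).differentiableAt
      (by simp)).hasFDerivAt
  have h2 := (hasFDerivAt_slice D.i D.ℓ (D.lift s)).comp ((1, 0), s) h1
  have h3 := (hasFDerivAt_id (𝕜 := ℂ) (((1 : ℂ), (0 : ℂ)), s)).congr_of_eventuallyEq
    (f₁ := slice D.i D.ℓ ∘ D.Ψ.symm)
    (Filter.eventually_of_mem (D.Ψ.open_target.mem_nhds ht) fun t ht => by
      change slice D.i D.ℓ (D.Ψ.symm t) = t
      rw [← D.coe_eq]
      exact D.Ψ.right_inv ht)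
  exact fun t => ⟨_, congrArg (fun f : (ℂ × ℂ) × (ℂ × ℂ) →L[ℂ] (ℂ × ℂ) × (ℂ × ℂ) => f t)
    (h2.unique h3)⟩

/-- Otherwise the volume form would vanish on the image of the surjective differential. -/
theorem sliceDet_ne_zero {s : ℂ × ℂ} (hs : s ∈ D.dom) : sliceDet D.i D.ℓ (D.lift s) ≠ 0 := by
  intro h0
  obtain ⟨T, hT⟩ : ∃ T : Fin 4 → (ℂ × ℂ) × (ℂ × ℂ), vol T ≠ 0 :=
    ⟨_, by rw [vol_eq 0 0 (1, 0) (0, 1) 0 1 0 0]; simp [wedge]⟩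
  obtain ⟨w, hw⟩ := (D.sliceDeriv_surjective hs).hasRightInverse
  have h1 := vol_sliceDeriv D.i D.ℓ (D.lift s) fun j => w (T j)
  rw [funext fun j => hw (T j), h0, zero_mul] at h1
  exact hT h1

/-- The coefficient of the residue form in the chart given by `D`. -/
def coeff (s : ℂ × ℂ) : ℂ := (sliceDet D.i D.ℓ (D.lift s))⁻¹

theorem coeff_ne_zero {s : ℂ × ℂ} (hs : s ∈ D.dom) : D.coeff s ≠ 0 :=
  inv_ne_zero (D.sliceDet_ne_zero hs)

theorem differentiableOn_coeff : DifferentiableOn ℂ D.coeff D.dom := by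
  refine DifferentiableOn.inv ?_ fun s hs => D.sliceDet_ne_zero hs
  exact (differentiable_sliceDet D.i D.ℓ).comp_differentiableOn
    (D.contDiffOn_lift.differentiableOn (by simp))

variable {D} in
/-- A map that is induced by a linear map `G` of `ℂ³ × ℂ` multiplies the residue form by
`det G / χ`, if `G` multiplies `F` by `χ`. -/
theorem coeff_transform {D' : ChartData} {G : V →L[ℂ] V} {χ : ℂ}
    (hGE : ∀ a, G (euler a) = euler (G a)) (hGF : ∀ a ξ, dF (G a) (G ξ) = χ * dF a ξ)
    {s : ℂ × ℂ} (hs : s ∈ D.dom) (hi : (G (D.lift s)).1 D'.i ≠ 0)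
    {σ : ℂ × ℂ → ℂ × ℂ} {σ' : ℂ × ℂ →L[ℂ] ℂ × ℂ} (hσ : HasFDerivAt σ σ' s)
    (hlift : ∀ᶠ t in 𝓝 s, slice D'.i D'.ℓ (normalize D'.i (G (D.lift t))) = ((1, 0), σ t))
    (hσs : σ s ∈ D'.dom) (hs' : D'.lift (σ s) = normalize D'.i (G (D.lift s))) (u v : ℂ × ℂ) :
    χ * (D'.coeff (σ s) * wedge (σ' u) (σ' v)) =
      LinearMap.det (G : V →ₗ[ℂ] V) * (D.coeff s * wedge u v) := by
  obtain ⟨a, ha⟩ : ∃ a, a = D.lift s := ⟨_, rfl⟩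
  obtain ⟨c, hc⟩ : ∃ c, c = ((G a).1 D'.i)⁻¹ := ⟨_, rfl⟩
  obtain ⟨b, hb⟩ : ∃ b, b = normalize D'.i (G a) := ⟨_, rfl⟩
  rw [← ha] at hi hs'
  have hc0 : c ≠ 0 := hc ▸ inv_ne_zero hi
  have hbc : b = weightedScale c (G a) := by rw [hb, normalize_eq, hc]
  have ha1 : a.1 D.i = 1 := ha ▸ D.lift_apply hs
  have haF : F a = 0 := ha ▸ D.F_lift hs
  rw [← hb] at hs'
  have hb1 : b.1 D'.i = 1 := hs' ▸ D'.lift_apply hσs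
  have hbF : F b = 0 := hs' ▸ D'.F_lift hσs
  obtain ⟨N, hN, hNe⟩ := hasFDerivAt_normalize D'.i hi
  -- By Euler's identity the Euler field is tangent to the cone F = 0, and its i-th coordinate is 1
  -- on the affine slice.
  have heul (i : Fin 3) (ℓ : V →L[ℂ] ℂ × ℂ) (x : V) (hx1 : x.1 i = 1) (hxF : F x = 0) :
      sliceDeriv i ℓ x (euler x) = ((1, 0), ℓ (euler x)) := by
    rw [sliceDeriv_apply, dF_euler, hxF, mul_zero]
    exact congrArg (fun y => ((y, (0 : ℂ)), ℓ (euler x))) hx1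
  -- Modulo the Euler field, the rescaled image of a tangent vector is its image under the
  -- derivative of the transition map.
  have hD : ∀ u : ℂ × ℂ, ∃ k : ℂ, sliceDeriv D'.i D'.ℓ b
      (weightedScale c (G (fderiv ℂ D.lift s u))) =
        ((0, 0), σ' u) + k • ((1, 0), D'.ℓ (euler b)) := by
    intro u
    have q1 : HasFDerivAt (fun t => G (D.lift t)) _ s :=
      G.hasFDerivAt.comp s (D.hasFDerivAt_lift hs)
    have q2 : HasFDerivAt (fun t => normalize D'.i (G (D.lift t))) _ s :=
      HasFDerivAt.comp (g := normalize D'.i) s (by rw [← ha]; exact hN) q1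
    have h1 : HasFDerivAt (fun t => slice D'.i D'.ℓ (normalize D'.i (G (D.lift t)))) _ s :=
      HasFDerivAt.comp (g := slice D'.i D'.ℓ) s
        (by rw [← ha, ← hb]; exact hasFDerivAt_slice D'.i D'.ℓ b) q2
    have h2 : HasFDerivAt (fun t : ℂ × ℂ => (((1 : ℂ), (0 : ℂ)), σ t))
      ((0 : ℂ × ℂ →L[ℂ] ℂ × ℂ).prod σ') s := (hasFDerivAt_const _ _).prodMk hσ
    have h3 := congrArg (fun f : ℂ × ℂ →L[ℂ] (ℂ × ℂ) × (ℂ × ℂ) => f u)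
      (h1.unique (h2.congr_of_eventuallyEq hlift))
    change sliceDeriv D'.i D'.ℓ b (N (G (fderiv ℂ D.lift s u))) = ((0, 0), σ' u) at h3
    rw [hNe, map_add, map_smul, ← hb, ← hc, heul _ _ b hb1 hbF] at h3
    refine ⟨(G (fderiv ℂ D.lift s u)).1 D'.i / (G a).1 D'.i, ?_⟩
    rw [← h3, neg_smul, neg_add_cancel_right]
  -- The residue form is det(Euler, ξ, ũ, ṽ) / dF(ξ) for any ξ with dF(ξ) ≠ 0, where ũ, ṽ lift u, v.
  -- `e1` and `e2` identify it with the coefficient times the area form at the source and at the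
  -- target.
  obtain ⟨ξ, -, hξ⟩ := exists_dF_ne_zero ha1 haF
  obtain ⟨k, hk⟩ := hD u
  obtain ⟨k', hk'⟩ := hD v
  let w : Fin 4 → V := ![euler a, ξ, fderiv ℂ D.lift s u, fderiv ℂ D.lift s v]
  let H : V →ₗ[ℂ] V := (weightedScale c : V →ₗ[ℂ] V) ∘ₗ (G : V →ₗ[ℂ] V)
  have e1 : sliceDet D.i D.ℓ a * basisV.det w = dF a ξ * wedge u v := by
    rw [← vol_sliceDeriv]
    have : (fun j => sliceDeriv D.i D.ℓ a (w j)) = ![((1, 0), D.ℓ (euler a)),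
        ((ξ.1 D.i, dF a ξ), D.ℓ ξ), ((0, 0), u) + (0 : ℂ) • ((1, 0), D.ℓ (euler a)),
        ((0, 0), v) + (0 : ℂ) • ((1, 0), D.ℓ (euler a))] := by
      funext j
      fin_cases j
      · exact heul _ _ a ha1 haF
      · rfl
      · have h := D.sliceDeriv_lift hs u
        rw [← ha] at h
        exact h.trans (by simp)
      · have h := D.sliceDeriv_lift hs v
        rw [← ha] at h
        exact h.trans (by simp)
    rw [this, vol_eq]
  have e2 : sliceDet D'.i D'.ℓ b * basisV.det (H ∘ w) =
      (c ^ 6 * (χ * dF a ξ)) * wedge (σ' u) (σ' v) := by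
    rw [← vol_sliceDeriv]
    have : (fun j => sliceDeriv D'.i D'.ℓ b ((H ∘ w) j)) = ![((1, 0), D'.ℓ (euler b)),
        (((H ξ).1 D'.i, c ^ 6 * (χ * dF a ξ)), D'.ℓ (H ξ)),
        ((0, 0), σ' u) + k • ((1, 0), D'.ℓ (euler b)),
        ((0, 0), σ' v) + k' • ((1, 0), D'.ℓ (euler b))] := by
      funext j
      fin_cases j
      · change sliceDeriv D'.i D'.ℓ b (weightedScale c (G (euler a))) = _
        rw [hGE, weightedScale_euler, ← hbc]
        exact heul _ _ b hb1 hbF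
      · change sliceDeriv D'.i D'.ℓ b (weightedScale c (G ξ)) = _
        rw [sliceDeriv_apply, ← hGF, ← dF_weightedScale, ← hbc]
        rfl
      · exact hk
      · exact hk'
    rw [this, vol_eq]
  -- The factor c⁶ now occurs on both sides: once from the determinant, once from the degree of F.
  rw [Module.Basis.det_comp, LinearMap.det_comp, det_weightedScale] at e2
  have n1 : sliceDet D.i D.ℓ a ≠ 0 := ha ▸ D.sliceDet_ne_zero hs
  have n2 : sliceDet D'.i D'.ℓ b ≠ 0 := hs' ▸ D'.sliceDet_ne_zero hσs
  rw [coeff, coeff, hs', ← ha]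
  have e3 : basisV.det w = dF a ξ * wedge u v / sliceDet D.i D.ℓ a := by
    rw [← e1]
    field_simp
  rw [e3] at e2
  have hc6 : c ^ 6 ≠ 0 := pow_ne_zero 6 hc0
  field_simp at e2 ⊢
  linear_combination -e2

end ChartData

end HessianK3

/-! ### The nowhere vanishing holomorphic 2-form -/

namespace HessianK3

open ComplexSurface

theorem ChartData.chart_mem_atlas (D : ChartData) : D.chart ∈ atlas (ℂ × ℂ) X := ⟨D, rfl⟩

/-- A self-map of `X` that is induced by a linear map `G` of `ℂ³ × ℂ` compatible with the weights,
which multiplies the differential of `F` by `χ`. -/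
structure IsInduced (G : V →L[ℂ] V) (χ : ℂ) (f : X → X) : Prop where
  map_euler : ∀ a, G (euler a) = euler (G a)
  dF_map : ∀ a ξ, dF (G a) (G ξ) = χ * dF a ξ
  apply_mk : ∀ a ha hF, ∃ ha' hF', f (X.mk a ha hF) = X.mk (G a) ha' hF'

/-- For the identity the transformation rule becomes the change-of-chart formula for the residue
form. -/
theorem isInduced_id : IsInduced (ContinuousLinearMap.id ℂ V) 1 id :=
  ⟨fun _ => rfl, fun _ _ => (one_mul _).symm, fun _ ha hF => ⟨ha, hF, rfl⟩⟩

namespace IsInduced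

variable {G : V →L[ℂ] V} {χ : ℂ} {f : X → X} (hf : IsInduced G χ f) {D D' : ChartData}
include hf

theorem apply_chart_symm {t : ℂ × ℂ} (ht : t ∈ D.dom) :
    ∃ ha hF, f (D.chart.symm t) = X.mk (G (D.lift t)) ha hF := by
  rw [D.chart_symm_apply ht]
  exact hf.apply_mk _ _ _

theorem chart_apply {t : ℂ × ℂ} (ht : t ∈ D.dom) :
    D'.chart (f (D.chart.symm t)) = D'.ℓ (normalize D'.i (G (D.lift t))) := by
  obtain ⟨ha, hF, h⟩ := hf.apply_chart_symm ht
  rw [h, D'.chart_mk]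

theorem mem_source {t : ℂ × ℂ} (ht : t ∈ D.dom) :
    f (D.chart.symm t) ∈ D'.chart.source ↔
      (G (D.lift t)).1 D'.i ≠ 0 ∧ normalize D'.i (G (D.lift t)) ∈ D'.Ψ.source := by
  obtain ⟨ha, hF, h⟩ := hf.apply_chart_symm ht
  rw [h, D'.mk_mem_source]

theorem slice_eq {t : ℂ × ℂ} (ht : t ∈ D.dom) (hi : (G (D.lift t)).1 D'.i ≠ 0) :
    slice D'.i D'.ℓ (normalize D'.i (G (D.lift t))) = ((1, 0), D'.chart (f (D.chart.symm t))) := by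
  obtain ⟨ha, hF, -⟩ := hf.apply_chart_symm ht
  rw [slice, normalize_apply hi, F_normalize hF, hf.chart_apply ht]

theorem eventually_mem_source {s : ℂ × ℂ} (hs : s ∈ D.dom)
    (hs' : f (D.chart.symm s) ∈ D'.chart.source) :
    ∀ᶠ t in 𝓝 s, t ∈ D.dom ∧ f (D.chart.symm t) ∈ D'.chart.source := by
  have hd := D.isOpen_dom.mem_nhds hs
  have h := (hf.mem_source hs).1 hs'
  have hG : ContinuousAt (fun t => G (D.lift t)) s :=
    G.continuous.continuousAt.comp (D.contDiffOn_lift.continuousOn.continuousAt hd)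
  have hGi : ContinuousAt (fun t => (G (D.lift t)).1 D'.i) s :=
    ((continuous_apply D'.i).comp continuous_fst).continuousAt.comp hG
  have hopen : IsOpen {a : V | a.1 D'.i ≠ 0} := isOpen_ne_fun (by fun_prop) (by fun_prop)
  have hn : ContinuousAt (fun t => normalize D'.i (G (D.lift t))) s :=
    ContinuousAt.comp (g := normalize D'.i)
      ((contDiffOn_normalize D'.i).continuousOn.continuousAt (hopen.mem_nhds h.1)) hG
  filter_upwards [hd, hGi.eventually_ne h.1, hn.eventually_mem (D'.Ψ.open_source.mem_nhds h.2)]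
    with t h1 h2 h3
  exact ⟨h1, (hf.mem_source h1).2 ⟨h2, h3⟩⟩

theorem differentiableAt {s : ℂ × ℂ} (hs : s ∈ D.dom)
    (hs' : f (D.chart.symm s) ∈ D'.chart.source) :
    DifferentiableAt ℂ (fun t => D'.chart (f (D.chart.symm t))) s := by
  have h := (hf.mem_source hs).1 hs'
  have h1 : DifferentiableAt ℂ (fun t => D'.ℓ (normalize D'.i (G (D.lift t)))) s := by
    obtain ⟨N, hN, -⟩ := hasFDerivAt_normalize D'.i h.1
    exact D'.ℓ.differentiableAt.comp s (DifferentiableAt.comp (g := normalize D'.i) s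
      hN.differentiableAt (G.differentiableAt.comp s (D.hasFDerivAt_lift hs).differentiableAt))
  exact h1.congr_of_eventuallyEq
    (Filter.eventually_of_mem (D.isOpen_dom.mem_nhds hs) fun t ht => hf.chart_apply ht)

theorem coeff_transform {s : ℂ × ℂ} (hs : s ∈ D.dom)
    (hs' : f (D.chart.symm s) ∈ D'.chart.source) {σ' : ℂ × ℂ →L[ℂ] ℂ × ℂ}
    (hσ : HasFDerivAt (fun t => D'.chart (f (D.chart.symm t))) σ' s) (u v : ℂ × ℂ) :
    χ * (D'.coeff (D'.chart (f (D.chart.symm s))) * wedge (σ' u) (σ' v)) =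
      LinearMap.det (G : V →ₗ[ℂ] V) * (D.coeff s * wedge u v) := by
  have h := (hf.mem_source hs).1 hs'
  refine ChartData.coeff_transform hf.map_euler hf.dF_map hs h.1 hσ ?_
    (D'.chart.map_source hs') ?_ u v
  · filter_upwards [hf.eventually_mem_source hs hs'] with t ht
    exact hf.slice_eq ht.1 ((hf.mem_source ht.1).1 ht.2).1
  · rw [ChartData.lift, ← hf.slice_eq hs h.1, ← D'.coe_eq]
    exact D'.Ψ.left_inv h.2

theorem mdifferentiable : MDifferentiable 𝓘(ℂ, ℂ × ℂ) 𝓘(ℂ, ℂ × ℂ) f := by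
  intro p
  obtain ⟨D, hD⟩ := exists_chart p
  obtain ⟨D', hD'⟩ := exists_chart (f p)
  have hp : D.chart.symm (D.chart p) = p := D.chart.left_inv hD
  have hs : D.chart p ∈ D.dom := D.chart.map_source hD
  have hs' : f (D.chart.symm (D.chart p)) ∈ D'.chart.source := by rwa [hp]
  have h1 : MDifferentiableAt 𝓘(ℂ, ℂ × ℂ) 𝓘(ℂ, ℂ × ℂ) D.chart p :=
    mdifferentiableAt_atlas D.chart_mem_atlas hD
  have h2 : MDifferentiableAt 𝓘(ℂ, ℂ × ℂ) 𝓘(ℂ, ℂ × ℂ)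
      (fun t => D'.chart (f (D.chart.symm t))) (D.chart p) :=
    (hf.differentiableAt hs hs').mdifferentiableAt
  have h3 : MDifferentiableAt 𝓘(ℂ, ℂ × ℂ) 𝓘(ℂ, ℂ × ℂ) D'.chart.symm
      (D'.chart (f (D.chart.symm (D.chart p)))) :=
    mdifferentiableAt_atlas_symm D'.chart_mem_atlas (D'.chart.map_source hs')
  refine (h3.comp p (h2.comp p h1)).congr_of_eventuallyEq ?_
  filter_upwards [D.chart.open_source.mem_nhds hD, (D.chart.continuousAt hD).eventually
    (hf.eventually_mem_source hs hs')] with p' h4 h5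
  have h6 := D'.chart.left_inv h5.2
  rw [D.chart.left_inv h4] at h6
  simp only [Function.comp_apply]
  rw [D.chart.left_inv h4, h6]

end IsInduced

/-- The standard area form on `ℂ × ℂ` as an alternating map. -/
def areaForm : (ℂ × ℂ) [⋀^Fin 2]→L[ℂ] ℂ :=
  { (Module.Basis.finTwoProd ℂ).det with
    cont := by
      change Continuous fun w : Fin 2 → ℂ × ℂ => (Module.Basis.finTwoProd ℂ).det w
      simp only [Module.Basis.det_apply, Matrix.det_fin_two, Module.Basis.toMatrix_apply,
        Module.Basis.coe_finTwoProd_repr, Matrix.cons_val]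
      fun_prop }

theorem areaForm_apply (w : Fin 2 → ℂ × ℂ) : areaForm w = wedge (w 0) (w 1) := by
  change (Module.Basis.finTwoProd ℂ).det w = _
  simp only [Module.Basis.det_apply, Matrix.det_fin_two, Module.Basis.toMatrix_apply,
    Module.Basis.coe_finTwoProd_repr, Matrix.cons_val, wedge]
  ring

theorem areaForm_basis : areaForm (Module.Basis.finTwoProd ℂ) = 1 :=
  (Module.Basis.finTwoProd ℂ).det_self

theorem eq_smul_areaForm (η : (ℂ × ℂ) [⋀^Fin 2]→L[ℂ] ℂ) :
    η = η (Module.Basis.finTwoProd ℂ) • areaForm :=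
  ContinuousAlternatingMap.toAlternatingMap_injective
    (η.toAlternatingMap.eq_smul_basis_det (Module.Basis.finTwoProd ℂ))

/-- The data of the preferred chart at a point. -/
def dataAt (p : X) : ChartData := (exists_chart p).choose

theorem mem_dataAt (p : X) : p ∈ (dataAt p).chart.source := (exists_chart p).choose_spec

/-- The residue of `(x dy ∧ dz ∧ dw ± …) / F`, a holomorphic 2-form without zeros. -/
def residueForm : TwoFormSection X := fun p =>
  ((dataAt p).coeff ((dataAt p).chart p) • areaForm : (ℂ × ℂ) [⋀^Fin 2]→L[ℂ] ℂ)

theorem coeff_dataAt_ne_zero (p : X) : (dataAt p).coeff ((dataAt p).chart p) ≠ 0 :=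
  (dataAt p).coeff_ne_zero ((dataAt p).chart.map_source (mem_dataAt p))

/-- Unfolds the manifold derivative: it is the ordinary derivative in the preferred chart at the
image point, to which `IsInduced.coeff_transform` applies. -/
theorem hasFDerivAt_chart_symm (D : ChartData) {s : ℂ × ℂ} (hs : s ∈ D.dom) :
    HasFDerivAt (fun t => (dataAt (D.chart.symm s)).chart (D.chart.symm t))
      (mfderiv 𝓘(ℂ, ℂ × ℂ) 𝓘(ℂ, ℂ × ℂ) D.chart.symm s : ℂ × ℂ →L[ℂ] ℂ × ℂ) s := by
  have h : MDifferentiableAt 𝓘(ℂ, ℂ × ℂ) 𝓘(ℂ, ℂ × ℂ) D.chart.symm s :=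
    mdifferentiableAt_atlas_symm D.chart_mem_atlas hs
  have h2 := h.hasMFDerivAt.2
  rw [ModelWithCorners.range_eq_univ] at h2
  exact hasFDerivWithinAt_univ.1 h2

theorem hasFDerivAt_of_mdifferentiableAt {f : X → X} {p : X}
    (h : MDifferentiableAt 𝓘(ℂ, ℂ × ℂ) 𝓘(ℂ, ℂ × ℂ) f p) :
    HasFDerivAt (fun t => (dataAt (f p)).chart (f ((dataAt p).chart.symm t)))
      (mfderiv 𝓘(ℂ, ℂ × ℂ) 𝓘(ℂ, ℂ × ℂ) f p : ℂ × ℂ →L[ℂ] ℂ × ℂ) ((dataAt p).chart p) := by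
  have h2 := h.hasMFDerivAt.2
  rw [ModelWithCorners.range_eq_univ] at h2
  exact hasFDerivWithinAt_univ.1 h2

theorem localForm_residueForm (D : ChartData) {s : ℂ × ℂ} (hs : s ∈ D.dom) :
    localForm residueForm D.chart s = D.coeff s • areaForm := by
  refine ContinuousAlternatingMap.ext fun (w : Fin 2 → ℂ × ℂ) => ?_
  have h := isInduced_id.coeff_transform hs (mem_dataAt (D.chart.symm s))
    (hasFDerivAt_chart_symm D hs) (w 0) (w 1)
  rw [one_mul] at h
  rw [ContinuousLinearMap.coe_id, LinearMap.det_id, one_mul] at h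
  let M : ℂ × ℂ →L[ℂ] ℂ × ℂ := mfderiv 𝓘(ℂ, ℂ × ℂ) 𝓘(ℂ, ℂ × ℂ) D.chart.symm s
  have h1 : localForm residueForm D.chart s w =
    (dataAt (D.chart.symm s)).coeff ((dataAt (D.chart.symm s)).chart (D.chart.symm s)) *
      areaForm (fun i => M (w i)) := rfl
  have h2 : (D.coeff s • areaForm) w = D.coeff s * areaForm w := rfl
  rw [h1, h2, areaForm_apply, areaForm_apply]
  exact h

theorem residueForm_mem : residueForm ∈ HolTwoForms X := by
  rintro _ ⟨D, rfl⟩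
  exact (D.differentiableOn_coeff.smul_const areaForm).congr fun s hs => localForm_residueForm D hs

theorem pullback_residueForm {G : V →L[ℂ] V} {χ : ℂ} {f : X → X} (hf : IsInduced G χ f)
    (hχ : χ ≠ 0) :
    pullback f residueForm = (LinearMap.det (G : V →ₗ[ℂ] V) / χ) • residueForm := by
  funext p
  refine ContinuousAlternatingMap.ext fun (w : Fin 2 → ℂ × ℂ) => ?_
  have hp := (dataAt p).chart.left_inv (mem_dataAt p)
  have h := hf.coeff_transform (D := dataAt p) (D' := dataAt (f p))
    ((dataAt p).chart.map_source (mem_dataAt p)) (by rw [hp]; exact mem_dataAt (f p))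
    (hasFDerivAt_of_mdifferentiableAt (hf.mdifferentiable p)) (w 0) (w 1)
  rw [hp] at h
  let M : ℂ × ℂ →L[ℂ] ℂ × ℂ := mfderiv 𝓘(ℂ, ℂ × ℂ) 𝓘(ℂ, ℂ × ℂ) f p
  have h1 : pullback f residueForm p w =
    (dataAt (f p)).coeff ((dataAt (f p)).chart (f p)) * areaForm (fun i => M (w i)) := rfl
  have h2 : ((LinearMap.det (G : V →ₗ[ℂ] V) / χ) • residueForm) p w =
    LinearMap.det (G : V →ₗ[ℂ] V) / χ * ((dataAt p).coeff ((dataAt p).chart p) *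
      areaForm w) := rfl
  rw [h1, h2, areaForm_apply, areaForm_apply, div_mul_eq_mul_div, eq_div_iff hχ, mul_comm]
  exact h

/-- The residue form has no zeros, so η is a function times it. In each chart this function is a
quotient of holomorphic coefficients, and a holomorphic function on a compact connected manifold is
constant. -/
theorem exists_smul_residueForm {η : TwoFormSection X} (hη : η ∈ HolTwoForms X) :
    ∃ c : ℂ, c • residueForm = η := by
  let b := Module.Basis.finTwoProd ℂ
  let h (p : X) : ℂ := (show (ℂ × ℂ) [⋀^Fin 2]→L[ℂ] ℂ from η p) b /
    (dataAt p).coeff ((dataAt p).chart p)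
  have hh (p : X) : η p = h p • residueForm p := by
    change (show (ℂ × ℂ) [⋀^Fin 2]→L[ℂ] ℂ from η p) =
      h p • ((dataAt p).coeff ((dataAt p).chart p) • areaForm : (ℂ × ℂ) [⋀^Fin 2]→L[ℂ] ℂ)
    rw [smul_smul, div_mul_cancel₀ _ (coeff_dataAt_ne_zero p)]
    exact eq_smul_areaForm _
  have hloc (D : ChartData) (s : ℂ × ℂ) (hs : s ∈ D.dom) :
      h (D.chart.symm s) = localForm η D.chart s b * (D.coeff s)⁻¹ := by
    have : localForm η D.chart s = h (D.chart.symm s) • localForm residueForm D.chart s := by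
      rw [localForm, hh]
      rfl
    rw [this, localForm_residueForm D hs, eq_mul_inv_iff_mul_eq₀ (D.coeff_ne_zero hs)]
    simp [b, areaForm_basis]
  have hd : MDifferentiable 𝓘(ℂ, ℂ × ℂ) 𝓘(ℂ, ℂ) h := by
    intro p
    obtain ⟨D, hD⟩ := exists_chart p
    have hs : D.chart p ∈ D.dom := D.chart.map_source hD
    have h1 : MDifferentiableAt 𝓘(ℂ, ℂ × ℂ) 𝓘(ℂ, ℂ × ℂ) D.chart p :=
      mdifferentiableAt_atlas D.chart_mem_atlas hD
    have h2 : DifferentiableOn ℂ (fun s => localForm η D.chart s b * (D.coeff s)⁻¹) D.dom :=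
      ((ContinuousAlternatingMap.apply ℂ (ℂ × ℂ) ℂ b).differentiable.comp_differentiableOn
        (hη D.chart D.chart_mem_atlas)).mul
        (D.differentiableOn_coeff.inv fun s hs => D.coeff_ne_zero hs)
    have h3 := ((h2.differentiableAt (D.isOpen_dom.mem_nhds hs)).mdifferentiableAt).comp p h1
    refine h3.congr_of_eventuallyEq ?_
    filter_upwards [D.chart.open_source.mem_nhds hD] with p' hp'
    rw [Function.comp_apply, ← hloc D _ (D.chart.map_source hp'), D.chart.left_inv hp']
  obtain ⟨c, hc⟩ := hd.exists_eq_const_of_compactSpace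
  refine ⟨c, ?_⟩
  funext p
  rw [hh, hc]
  rfl

theorem residueForm_ne_zero : residueForm ≠ 0 := by
  intro h0
  have h1 : (dataAt basePoint).coeff ((dataAt basePoint).chart basePoint) *
      areaForm (Module.Basis.finTwoProd ℂ) = 0 :=
    congrArg (fun η : (ℂ × ℂ) [⋀^Fin 2]→L[ℂ] ℂ => η (Module.Basis.finTwoProd ℂ))
      (congrFun h0 basePoint)
  rw [areaForm_basis, mul_one] at h1
  exact coeff_dataAt_ne_zero basePoint h1

theorem finrank_holTwoForms : Module.finrank ℂ (HolTwoForms X) = 1 := by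
  refine finrank_eq_one (⟨residueForm, residueForm_mem⟩ : HolTwoForms X)
    (fun h => residueForm_ne_zero (congrArg Subtype.val h)) fun η => ?_
  obtain ⟨c, hc⟩ := exists_smul_residueForm η.2
  exact ⟨c, Subtype.ext hc⟩

theorem isSymplectic_of_isInduced {G : V →L[ℂ] V} {χ : ℂ} {f : X → X} (hf : IsInduced G χ f)
    (hχ : χ ≠ 0) (hG : LinearMap.det (G : V →ₗ[ℂ] V) = χ) : IsSymplectic f := by
  intro η hη
  obtain ⟨c, rfl⟩ := exists_smul_residueForm hη
  have h : pullback f (c • residueForm) = c • pullback f residueForm := rfl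
  rw [h, pullback_residueForm hf hχ, hG, div_self hχ, one_smul]

end HessianK3

/-! ### The lift of the Hessian group to the surface -/

namespace HessianK3

open ComplexSurface Hessian Matrix

/-- The factor by which `Φ₆` is multiplied. -/
def sexticFactor (A : GL (Fin 3) ℂ) : ℂ := Φ₆ (A.val *ᵥ ![1, 0, 0])

/-- The factor by which the lift to `ℂ³ × ℂ` multiplies the last coordinate. -/
def liftFactor (A : GL (Fin 3) ℂ) : ℂ := sexticFactor A ^ 2 / A.val.det ^ 3

/-- The lift of a linear transformation to `ℂ³ × ℂ`. -/
def coneMap (A : GL (Fin 3) ℂ) : V →L[ℂ] V :=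
  (LinearMap.toContinuousLinearMap A.val.mulVecLin).prodMap
    (liftFactor A • ContinuousLinearMap.id ℂ ℂ)

theorem coneMap_apply (A : GL (Fin 3) ℂ) (a : V) :
    coneMap A a = (A.val *ᵥ a.1, liftFactor A * a.2) := rfl

theorem det_coneMap (A : GL (Fin 3) ℂ) :
    LinearMap.det (coneMap A : V →ₗ[ℂ] V) = A.val.det * liftFactor A := by
  have : (coneMap A : V →ₗ[ℂ] V) =
      (Matrix.toLin' A.val).prodMap (liftFactor A • (LinearMap.id : ℂ →ₗ[ℂ] ℂ)) := rfl
  rw [this, LinearMap.det_prodMap, LinearMap.det_toLin', LinearMap.det_smul]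
  simp

theorem Φ₆_basis : Φ₆ ![1, 0, 0] = 1 := by simp [Φ₆]

theorem det_ne_zero (A : GL (Fin 3) ℂ) : A.val.det ≠ 0 := (Matrix.isUnits_det_units A).ne_zero

theorem Φ₆_mulVec {A : GL (Fin 3) ℂ} (hA : A ∈ sexticSemiinvariance) (v : Fin 3 → ℂ) :
    Φ₆ (A.val *ᵥ v) = sexticFactor A * Φ₆ v := by
  obtain ⟨c, hc, -⟩ := hA
  rw [sexticFactor, hc, hc, Φ₆_basis, mul_one]

theorem sexticFactor_pow_three {A : GL (Fin 3) ℂ} (hA : A ∈ sexticSemiinvariance) :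
    sexticFactor A ^ 3 = A.val.det ^ 6 := by
  obtain ⟨c, hc, h⟩ := hA
  rw [sexticFactor, hc, Φ₆_basis, mul_one, h]

theorem sexticFactor_ne_zero {A : GL (Fin 3) ℂ} (hA : A ∈ sexticSemiinvariance) :
    sexticFactor A ≠ 0 := by
  intro h
  have := sexticFactor_pow_three hA
  rw [h, zero_pow (by norm_num)] at this
  exact pow_ne_zero 6 (det_ne_zero A) this.symm

/-- With c the sextic factor, c⁴ / det⁶ = c⁴ / c³ = c. A multiplicative square root of c is what
lets the group itself, not a double cover of it, act on w² + Φ₆ = 0. -/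
theorem liftFactor_sq {A : GL (Fin 3) ℂ} (hA : A ∈ sexticSemiinvariance) :
    liftFactor A ^ 2 = sexticFactor A := by
  have h := sexticFactor_pow_three hA
  have h0 := det_ne_zero A
  rw [liftFactor, div_pow, ← pow_mul, ← pow_mul, div_eq_iff (pow_ne_zero _ h0), ← h]
  ring

theorem F_coneMap {A : GL (Fin 3) ℂ} (hA : A ∈ sexticSemiinvariance) (a : V) :
    F (coneMap A a) = sexticFactor A * F a := by
  rw [F, F, coneMap_apply, Φ₆_mulVec hA, mul_pow, liftFactor_sq hA, mul_add]

theorem coneMap_ne_zero {A : GL (Fin 3) ℂ} {a : V} (ha : a ≠ 0) (hF : F a = 0) :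
    coneMap A a ≠ 0 := by
  intro h
  have h1 : A.val *ᵥ a.1 = 0 := congrArg Prod.fst h
  refine fst_ne_zero ha hF ?_
  rw [← one_mulVec a.1, ← Units.val_one, ← inv_mul_cancel A, Units.val_mul, ← mulVec_mulVec, h1,
    mulVec_zero]

theorem sexticFactor_mul {A B : GL (Fin 3) ℂ} (hA : A ∈ sexticSemiinvariance) :
    sexticFactor (A * B) = sexticFactor A * sexticFactor B := by
  rw [sexticFactor, Units.val_mul, ← mulVec_mulVec, Φ₆_mulVec hA, sexticFactor, sexticFactor]

theorem coneMap_mul {A B : GL (Fin 3) ℂ} (hA : A ∈ sexticSemiinvariance) (a : V) :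
    coneMap (A * B) a = coneMap A (coneMap B a) := by
  have : liftFactor (A * B) = liftFactor A * liftFactor B := by
    rw [liftFactor, sexticFactor_mul hA, Units.val_mul, det_mul, mul_pow, mul_pow,
      mul_div_mul_comm, liftFactor, liftFactor]
  rw [coneMap_apply, coneMap_apply, coneMap_apply, this, Units.val_mul, ← mulVec_mulVec, mul_assoc]

/-- The lift factor of a scalar is (u⁶)² / (u³)³ = u³, exactly the weight of w, so scalars act
trivially on X. -/
theorem coneMap_scalar (u : ℂˣ) (a : V) :
    coneMap (GeneralLinearGroup.scalar (Fin 3) u) a = ((u : ℂ) • a.1, (u : ℂ) ^ 3 * a.2) := by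
  have hs (v : Fin 3 → ℂ) : (GeneralLinearGroup.scalar (Fin 3) u).val *ᵥ v = (u : ℂ) • v := by
    rw [GeneralLinearGroup.coe_scalar, scalar_apply, ← smul_one_eq_diagonal, smul_mulVec,
      one_mulVec]
  have hl : liftFactor (GeneralLinearGroup.scalar (Fin 3) u) = (u : ℂ) ^ 3 := by
    have hu := u.ne_zero
    rw [liftFactor, sexticFactor, hs, GeneralLinearGroup.coe_scalar, scalar_apply, det_diagonal,
      Fin.prod_const]
    simp [Φ₆]
    field_simp
  rw [coneMap_apply, hs, hl]

theorem coneMap_weighted (A : GL (Fin 3) ℂ) (c : ℂ) (a : V) :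
    coneMap A (c • a.1, c ^ 3 * a.2) = (c • (coneMap A a).1, c ^ 3 * (coneMap A a).2) := by
  simp only [coneMap_apply, mulVec_smul]
  exact Prod.ext rfl (by ring)

/-- The self-map of `X` that lifts a linear transformation. -/
def surfaceMap (A : sexticSemiinvariance) (p : X) : X :=
  X.mk (coneMap A p.rep) (coneMap_ne_zero p.rep_ne p.F_rep)
    (by rw [F_coneMap A.2, p.F_rep, mul_zero])

theorem surfaceMap_mk (A : sexticSemiinvariance) (a : V) (ha : a ≠ 0) (hF : F a = 0) :
    surfaceMap A (X.mk a ha hF) = X.mk (coneMap A a) (coneMap_ne_zero ha hF)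
      (by rw [F_coneMap A.2, hF, mul_zero]) := by
  obtain ⟨c, hc, h⟩ := X.mk_eq_mk.1 (X.mk_rep (X.mk a ha hF))
  refine X.mk_eq_mk.2 ⟨c, hc, ?_⟩
  rw [← coneMap_weighted, ← h]

theorem surfaceMap_scalar {A : sexticSemiinvariance} {u : ℂˣ}
    (h : A.1 = GeneralLinearGroup.scalar (Fin 3) u) (p : X) : surfaceMap A p = p := by
  induction p using X.ind with
  | h a ha hF =>
    rw [surfaceMap_mk]
    exact (X.mk_eq_mk.2 ⟨u, u.ne_zero, by rw [h, coneMap_scalar]⟩).symm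

theorem isInduced_surfaceMap (A : sexticSemiinvariance) :
    IsInduced (coneMap A) (sexticFactor A) (surfaceMap A) where
  map_euler a := by
    simp only [coneMap_apply, euler]
    exact Prod.ext rfl (by ring)
  -- Differentiate the identity `F_coneMap` in two ways.
  dF_map a ξ := by
    have hd (x : V) : HasFDerivAt F (fderiv ℂ F x) x :=
      (contDiff_F.differentiable (by simp)).differentiableAt.hasFDerivAt
    have h1 : HasFDerivAt (fun b => F (coneMap A.1 b)) _ a :=
      (hd (coneMap A a)).comp a (coneMap A.1).hasFDerivAt
    have h2 : HasFDerivAt (fun b => F (coneMap A.1 b)) _ a :=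
      ((hd a).const_mul (sexticFactor A)).congr_of_eventuallyEq
        (Filter.Eventually.of_forall (F_coneMap A.2))
    have h3 := congrArg (fun f : V →L[ℂ] ℂ => f ξ) (h1.unique h2)
    rw [← fderiv_F, ← fderiv_F]
    exact h3
  apply_mk a ha hF := ⟨_, _, surfaceMap_mk A a ha hF⟩

/-- The action of the linear transformations on `X` by holomorphic automorphisms. -/
def linearLift : sexticSemiinvariance →* HolAut X :=
  (MonoidHom.toHomPerm
    { toFun := fun A => (surfaceMap A : Function.End X)
      map_one' := funext fun p => surfaceMap_scalar (u := 1) (by simp) p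
      map_mul' := fun A B => funext fun p => by
        change surfaceMap (A * B) p = surfaceMap A (surfaceMap B p)
        induction p using X.ind with
        | h a ha hF =>
          rw [surfaceMap_mk, surfaceMap_mk, surfaceMap_mk]
          exact X.mk_eq_mk.2 ⟨1, one_ne_zero, by
            rw [one_smul, one_pow, one_mul]
            exact (coneMap_mul A.2 a).symm⟩ }).codRestrict (HolAut X) fun A =>
    ⟨(isInduced_surfaceMap A).mdifferentiable, (isInduced_surfaceMap A⁻¹).mdifferentiable⟩

theorem linearLift_apply (A : sexticSemiinvariance) (p : X) :
    (linearLift A).1 p = surfaceMap A p := rfl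

/-- When the sextic factor is det², the lift factor is det⁴ / det³ = det, so the cone map has
determinant det², equal to the factor of F. -/
theorem isSymplectic_linearLift (A : sexticSemiinvariance) (hA : A.1 ∈ sexticInvariance) :
    IsSymplectic (linearLift A).1 := by
  refine isSymplectic_of_isInduced (isInduced_surfaceMap A) (sexticFactor_ne_zero A.2) ?_
  have h : sexticFactor A = A.1.val.det ^ 2 := by
    rw [sexticFactor, hA, Φ₆_basis, mul_one]
  have h0 := det_ne_zero A.1
  rw [det_coneMap, liftFactor, h]
  field_simp

theorem q_linearLift (A : sexticSemiinvariance) (p : X) :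
    q ((linearLift A).1 p) = (ProjGenLinGroup.mk A.1 : PGL(Fin 3, ℂ)) • q p := by
  rw [linearLift_apply]
  induction p using X.ind with
  | h a ha hF =>
    rw [surfaceMap_mk, q_mk, q_mk, Projectivization.PGL.mk_smul_mk]
    rfl

/-- The projection from the linear stabilizer to the Hessian group. -/
def toHessianGroup : linearStabilizer →* hessianGroup :=
  ProjGenLinGroup.mk.subgroupMap linearStabilizer

theorem surjective_toHessianGroup : Function.Surjective toHessianGroup :=
  MonoidHom.subgroupMap_surjective _ _

/-- The lift of the Hessian group to the group of automorphisms of `X`. -/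
def hessianLift : hessianGroup →* HolAut X :=
  toHessianGroup.liftOfSurjective surjective_toHessianGroup
    ⟨linearLift.comp (Subgroup.inclusion linearStabilizer_le_sexticSemiinvariance), by
      -- The kernel of the projection to PGL consists of scalar matrices, which act trivially on X.
      intro A hA
      have h : ProjGenLinGroup.mk A.1 = 1 := congrArg Subtype.val hA
      obtain ⟨u, hu⟩ := ProjGenLinGroup.mk_eq_mk_iff.1 (h.symm : ProjGenLinGroup.mk 1 = _)
      rw [one_mul] at hu
      exact Subtype.ext (Equiv.ext fun p => surfaceMap_scalar hu.symm p)⟩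

theorem hessianLift_apply (A : linearStabilizer) : hessianLift (toHessianGroup A) =
    linearLift (Subgroup.inclusion linearStabilizer_le_sexticSemiinvariance A) :=
  MonoidHom.liftOfRightInverse_comp_apply _ _ _ _ _

theorem q_hessianLift (g : hessianGroup) (p : X) :
    q ((hessianLift g).1 p) = (g : PGL(Fin 3, ℂ)) • q p := by
  obtain ⟨A, rfl⟩ := surjective_toHessianGroup g
  rw [hessianLift_apply]
  exact q_linearLift _ p

/-- A projective transformation that fixes all points of the plane is trivial. -/
theorem eq_one_of_smul_eq {g : PGL(Fin 3, ℂ)} (h : ∀ x : ℙ ℂ (Fin 3 → ℂ), g • x = x) : g = 1 := by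
  induction g using ProjGenLinGroup.induction_on with
  | mk A =>
    have h1 (v : Fin 3 → ℂ) (hv : v ≠ 0) : ∃ c : ℂ, c • v = A.val *ᵥ v := by
      have := h (Projectivization.mk ℂ v hv)
      rw [Projectivization.PGL.mk_smul_mk, Projectivization.mk_eq_mk_iff'] at this
      exact this
    -- Every nonzero vector is an eigenvector, so the map is a scalar.
    obtain ⟨a, ha⟩ := (Matrix.toLin' A.val).exists_eq_smul_id_of_forall_notLinearIndependent
      fun v hv => by
        rcases eq_or_ne v 0 with rfl | h0
        · exact hv.ne_zero 0 rfl
        · obtain ⟨c, hc⟩ := h1 v h0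
          rw [LinearIndependent.pair_iff] at hv
          have := hv c (-1) (by
            rw [Matrix.toLin'_apply, hc, neg_smul, one_smul, add_neg_cancel])
          simp at this
    have hA : A.val = a • 1 := by
      apply Matrix.toLin'.injective
      rw [ha, map_smul, Matrix.toLin'_one]
      rfl
    have ha0 : a ≠ 0 := by
      rintro rfl
      exact det_ne_zero A (by simp [hA])
    rw [← ProjGenLinGroup.mk_scalar (n := Fin 3) (Units.mk0 a ha0)]
    refine congrArg _ (Units.ext ?_)
    rw [hA, GeneralLinearGroup.coe_scalar, scalar_apply, smul_one_eq_diagonal]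
    rfl

/-- Since q is surjective and equivariant, an element acting trivially on X acts trivially on the
plane. -/
theorem injective_hessianLift : Function.Injective hessianLift := by
  rw [injective_iff_map_eq_one]
  intro g hg
  refine Subtype.ext (eq_one_of_smul_eq fun x => ?_)
  obtain ⟨p, rfl⟩ := surjective_q x
  rw [← q_hessianLift, hg]
  rfl

theorem isSymplectic_hessianLift (Q : Sylow 2 SL23) (g : hessianGroup)
    (hg : (g : PGL(Fin 3, ℂ)) ∈ H72 Q) : IsSymplectic (hessianLift g).1 := by
  obtain ⟨A, rfl⟩ := surjective_toHessianGroup g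
  rw [hessianLift_apply]
  exact isSymplectic_linearLift _ (mem_sexticInvariance (A := A.1) hg)

end HessianK3

end

theorem mainTheorem3 :
    (∀ Q : Sylow 2 Hessian.SL23,
      Hessian.H72 Q ≤ Hessian.hessianGroup ∧
      ((Hessian.H72 Q).subgroupOf Hessian.hessianGroup).Normal ∧
      (Hessian.Γ.subgroupOf (Hessian.H72 Q)).Normal ∧
      Disjoint Hessian.Γ (Hessian.Q8 Q) ∧
      Nonempty (Hessian.Q8 Q ≃* QuaternionGroup 2)) ∧
    Module.finrank ℂ (ComplexSurface.HolTwoForms HessianK3.X) = 1 ∧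
    ∃ ρ : Hessian.hessianGroup →* ComplexSurface.HolAut HessianK3.X,
      Function.Injective ρ ∧
      (∀ (g : Hessian.hessianGroup) (p : HessianK3.X),
        HessianK3.q ((ρ g).1 p) = (g : PGL(Fin 3, ℂ)) • HessianK3.q p) ∧
      ∀ (Q : Sylow 2 Hessian.SL23) (g : Hessian.hessianGroup),
        (g : PGL(Fin 3, ℂ)) ∈ Hessian.H72 Q → ComplexSurface.IsSymplectic (ρ g).1 := by
  refine ⟨fun Q => ⟨?_, ?_, Hessian.normal_Γ_subgroupOf_H72 Q, ?_, ?_⟩,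
    HessianK3.finrank_holTwoForms, HessianK3.hessianLift, HessianK3.injective_hessianLift,
    HessianK3.q_hessianLift, HessianK3.isSymplectic_hessianLift⟩
  · rw [Hessian.hessianGroup_eq]
    exact Hessian.H72_le Q
  · apply Subgroup.normal_subgroupOf_of_le_normalizer
    rw [Hessian.hessianGroup_eq]
    exact Hessian.le_normalizer_H72 Q
  · rw [Hessian.Q8_eq_quaternion]
    exact Hessian.disjoint_Γ_quaternion
  · rw [Hessian.Q8_eq_quaternion]
    exact ⟨Hessian.quaternionEquiv.symm⟩
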